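/- Let $d\ge 1$ be an integer and let $\{X_{\mathbf j}:\mathbf j\in\mathbb Z^d\}$ be real random variables on a common probability space such that: (a) they are negatively associated: for all disjoint finite sets $A,B\subset\mathbb Z^d$ and all coordinatewise nondecreasing Borel functions $f:\mathbb R^{A}\to\mathbb R$, $g:\mathbb R^{B}\to\mathbb R$ such that $f(X_{\mathbf i},\mathbf i\in A)$ and $g(X_{\mathbf j},\mathbf j\in B)$ have finite second moments, $\mathrm{Cov}\big(f(X_{\mathbf i},\mathbf i\in A),g(X_{\mathbf j},\mathbf j\in B)\big)\le 0$; (b) they are second order stationary: $\mathbb E X_{\mathbf j}^2<\infty$ and $\mathrm{Cov}(X_{\mathbf i},X_{\mathbf j})=R(\mathbf j-\mathbf i)$ for all $\mathbf i,\mathbf j\in\mathbb Z^d$, where $R(\mathbf k)=\mathrm{Cov}(X_{\mathbf 0},X_{\mathbf k})$; (c) for some $K>0$, $|X_{\mathbf j}|\le K$ almost surely for every $\mathbf j\in\mathbb Z^d$; (d) there are $\lambda>0$ and $\kappa_0>0$ with $-R(\mathbf k)\le\kappa_0e^{-\lambda|\mathbf k|_1}$ for all $\mathbf k\in\mathbb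 Z^d\setminus\{\mathbf 0\}$, where $|\mathbf k|_1=\sum_{s}|k_s|$. For $\mathbf k\in\mathbb Z^d$ and an integer $n\ge1$ let $B^n_{\mathbf k}=\{\mathbf j\in\mathbb Z^d: k_s\le j_s<k_s+n \text{ for } s=1,\dots,d\}$, $S^n_{\mathbf k}=\sum_{\mathbf j\in B^n_{\mathbf k}}X_{\mathbf j}$ and, with $\mathbf 1=(1,\dots,1)$, $$A_n=\frac1{n^d}\sum_{\mathbf i,\mathbf j\in B^n_{\mathbf 1}}R(\mathbf i-\mathbf j),\qquad W^n_{\mathbf k}=\frac{S^n_{\mathbf k}-\mathbb E S^n_{\mathbf k}}{\sqrt{n^dA_n}},$$ and assume that $\inf_{n\ge1}A_n>0$. Let $$\mu_\lambda=\frac{e^\lambda}{(e^\lambda-1)^2},\qquad \nu_\lambda=\frac{e^{2\lambda}}{(e^\lambda-1)^2},\qquad \gamma_{\lambda,d}=(4\mu_\lambda+2\nu_\lambda)^d-(2\nu_\lambda)^d,\qquad C_{\lambda,\kappa_0,d}=\frac{10Kd\sqrt{A_n}}{5.2\,\kappa_0\gamma_{\lambda,d}}.$$ Then, for every $\mathbf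 k\in\mathbb Z^d$, with $Z$ a standard normal random variable, $$d_1\big(\mathcal L(W^n_{\mathbf k}),\mathcal L(Z)\big):=\int_{-\infty}^\infty\big|P(W^n_{\mathbf k}\le t)-P(Z\le t)\big|\,dt\;\le\;\frac{\kappa_1}{n^{d/(2d+2)}}$$ for all integers $n\ge1$ with $n\ge\max\big\{C_{\lambda,\kappa_0,d}^{2/d},\,C_{\lambda,\kappa_0,d}^{-2/(d+2)}\big\}$, where $$\kappa_1=\left(\frac{10K(5.2\,\kappa_0\gamma_{\lambda,d})^d}{A_n^{d+1/2}}\right)^{1/(d+1)}\left(\frac1{d^{d/(d+1)}}+2d^{1/(d+1)}\right).$$ -/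

import Mathlib

open MeasureTheory ProbabilityTheory
open scoped ENNReal

noncomputable section

namespace NARandomField

/-- The `L¹` (Wasserstein) distance between two laws on the real line,
`∫ |μ (-∞, t] - ν (-∞, t]| dt`, as an extended nonnegative number. -/
def d1 (μ ν : Measure ℝ) : ℝ≥0∞ :=
  ∫⁻ t : ℝ, ENNReal.ofReal |μ.real (Set.Iic t) - ν.real (Set.Iic t)|

/-- Negative association of a family of real random variables: for any two disjoint finite sets
`A`, `B` of indices, coordinatewise nondecreasing Borel functions of `(X i, i ∈ A)` and of
`(X j, j ∈ B)` with finite second moments have nonpositive covariance. -/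
def NegativelyAssociated {Ω ι : Type*} [MeasurableSpace Ω] (P : Measure Ω) (X : ι → Ω → ℝ) :
    Prop :=
  ∀ A B : Finset ι, Disjoint A B →
    ∀ (f : (A → ℝ) → ℝ) (g : (B → ℝ) → ℝ), Monotone f → Monotone g →
      Measurable f → Measurable g →
      MemLp (fun ω => f (fun i : A => X i ω)) 2 P →
      MemLp (fun ω => g (fun j : B => X j ω)) 2 P →
      covariance (fun ω => f (fun i : A => X i ω)) (fun ω => g (fun j : B => X j ω)) P ≤ 0

section Field

variable {Ω : Type*} [MeasurableSpace Ω] {d : ℕ}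

/-- The covariance function `R(k) = Cov(X₀, X_k)`. -/
def covFun (P : Measure Ω) (X : (Fin d → ℤ) → Ω → ℝ) (k : Fin d → ℤ) : ℝ :=
  covariance (X 0) (X k) P

/-- Second order stationarity: finite second moments, and `Cov(X_i, X_j) = R(j - i)`. -/
def SecondOrderStationary (P : Measure Ω) (X : (Fin d → ℤ) → Ω → ℝ) : Prop :=
  (∀ j, MemLp (X j) 2 P) ∧ ∀ i j, covariance (X i) (X j) P = covFun P X (j - i)

/-- The `L¹` norm of a lattice vector. -/
def norm1 (k : Fin d → ℤ) : ℝ := ∑ s, |(k s : ℝ)|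

/-- The block `{j : k s ≤ j s < k s + n for every coordinate s}`. -/
def block (k : Fin d → ℤ) (n : ℕ) : Finset (Fin d → ℤ) :=
  Fintype.piFinset fun s => Finset.Ico (k s) (k s + n)

/-- The block sum `S_k^n`. -/
def blockSum (X : (Fin d → ℤ) → Ω → ℝ) (k : Fin d → ℤ) (n : ℕ) (ω : Ω) : ℝ :=
  ∑ j ∈ block k n, X j ω

/-- `A_n = n^{-d} ∑_{i, j ∈ B_1^n} R(i - j)`. -/
def avgCov (P : Measure Ω) (X : (Fin d → ℤ) → Ω → ℝ) (n : ℕ) : ℝ :=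
  1 / (n : ℝ) ^ d *
    ∑ i ∈ block (1 : Fin d → ℤ) n, ∑ j ∈ block (1 : Fin d → ℤ) n, covFun P X (i - j)

/-- The standardized block sum `W_k^n = (S_k^n - E S_k^n) / √(n^d A_n)`. -/
def stdBlockSum (P : Measure Ω) (X : (Fin d → ℤ) → Ω → ℝ) (k : Fin d → ℤ) (n : ℕ) (ω : Ω) : ℝ :=
  (blockSum X k n ω - ∫ ω', blockSum X k n ω' ∂P) / √((n : ℝ) ^ d * avgCov P X n)

end Field

/-- `μ_λ = e^λ / (e^λ - 1)²`. -/
def muC (l : ℝ) : ℝ := Real.exp l / (Real.exp l - 1) ^ 2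

/-- `ν_λ = e^{2λ} / (e^λ - 1)²`. -/
def nuC (l : ℝ) : ℝ := Real.exp (2 * l) / (Real.exp l - 1) ^ 2

/-- `γ_{λ,d} = (4 μ_λ + 2 ν_λ)^d - (2 ν_λ)^d`. -/
def gammaC (l : ℝ) (d : ℕ) : ℝ := (4 * muC l + 2 * nuC l) ^ d - (2 * nuC l) ^ d

/-- `C_{λ,κ₀,d} = 10 K d √A / (5.2 κ₀ γ_{λ,d})`, where `A` stands for `A_n`. -/
def threshC (K l κ₀ A : ℝ) (d : ℕ) : ℝ :=
  10 * K * d * √A / (5.2 * κ₀ * gammaC l d)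

/-- `κ₁ = (10 K (5.2 κ₀ γ_{λ,d})^d / A^{d + 1/2})^{1/(d+1)} (d^{-d/(d+1)} + 2 d^{1/(d+1)})`,
where `A` stands for `A_n`. -/
def kappa1 (K l κ₀ A : ℝ) (d : ℕ) : ℝ :=
  (10 * K * (5.2 * κ₀ * gammaC l d) ^ d / A ^ ((d : ℝ) + 1 / 2)) ^ (1 / ((d : ℝ) + 1)) *
    (1 / (d : ℝ) ^ ((d : ℝ) / ((d : ℝ) + 1)) + 2 * (d : ℝ) ^ (1 / ((d : ℝ) + 1)))

end NARandomField

end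

/-!
The proof combines Stein's method for negatively associated summands with a tiling of the block.

*Stein's method* (`d1_sum_le`). Let `W = ∑ ξ i` have variance one, with centered summands that range
in intervals of length `B`, and let `V = -∑ cov (ξ i, W - ξ i)`. By duality
(`d1_le_of_forall_C1`) the distance of `W` to the normal law is a supremum of
`E h(W) - E h(Z)` over `C¹` functions with `|h'| ≤ 1`, and Stein's equation
(`exists_stein_solution`) turns this into `E [f'(W) - W f(W)]` with `f'` bounded and Lipschitz.
Expanding `ξ i * f(W)` at `W - ξ i` leaves covariances between Lipschitz functions of `ξ i` and of
`W - ξ i`. Negative association bounds these by the covariance of `ξ i` and `W - ξ i` itself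
(`NegativelyAssociated.abs_covariance_lipschitz_le`), so that the total is at most
`5 B + 10.4 V`.

*Tiling* (`d1_stdBlockSum_le`). The summands are the standardized sums over cells of side `L`, so
`B = 2 K L ^ d / √(n ^ d A)`. The covariances between different cells are bounded by exponential
weights (`sum_sum_exp_off_cell_le`): their total is `T ^ d - D ^ d`, where `T` and `D` are the
one-dimensional sums over all pairs and over the pairs in a common cell, and `T - D` is of order
`n / L` because only pairs near the boundaries of the cells contribute. This gives
`V ≤ κ₀ γ / (2 A L)`.

The resulting bound has the form `a L ^ d + b / L`. It is used with `L` the integer part of the real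
minimizer `x` of `a x ^ d + b / x` (`minimizer_value`). As `x ≥ 1`, rounding at most doubles the
second term.
-/

namespace NARandomField

open scoped NNReal

/-! ### Duality for the distance `d1` -/

/-- The kernel `1[w ≤ t] - 1[0 ≤ t]`, whose integral in `t` against a weight `s` is
`-∫ t in 0..w, s t`. -/
noncomputable def stepDiff (w t : ℝ) : ℝ :=
  (Set.Ici w).indicator 1 t - (Set.Ici (0 : ℝ)).indicator 1 t

lemma stepDiff_of_nonneg {w : ℝ} (hw : 0 ≤ w) :
    stepDiff w = fun t => -(Set.Ico 0 w).indicator 1 t := by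
  funext t
  simp only [stepDiff, Set.indicator_apply, Set.mem_Ici, Set.mem_Ico, Pi.one_apply]
  split_ifs <;> grind

lemma stepDiff_of_nonpos {w : ℝ} (hw : w ≤ 0) :
    stepDiff w = (Set.Ico w 0).indicator 1 := by
  funext t
  simp only [stepDiff, Set.indicator_apply, Set.mem_Ici, Set.mem_Ico, Pi.one_apply]
  split_ifs <;> grind

lemma measurable_uncurry_stepDiff : Measurable (Function.uncurry stepDiff) := by
  have h1 : Measurable fun p : ℝ × ℝ => ({p : ℝ × ℝ | p.1 ≤ p.2}).indicator (1 : ℝ × ℝ → ℝ) p :=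
    measurable_one.indicator (measurableSet_le measurable_fst measurable_snd)
  have h2 : Measurable fun p : ℝ × ℝ => (Set.Ici (0 : ℝ)).indicator (1 : ℝ → ℝ) p.2 :=
    (measurable_one.indicator measurableSet_Ici).comp measurable_snd
  exact h1.sub h2

lemma integrable_stepDiff (w : ℝ) : Integrable (stepDiff w) := by
  have key : ∀ a b : ℝ, Integrable ((Set.Ico a b).indicator (1 : ℝ → ℝ)) := fun a b =>
    (integrable_indicator_iff measurableSet_Ico).2 (integrableOn_const (by simp))
  rcases le_total 0 w with hw | hw
  · rw [stepDiff_of_nonneg hw]; exact (key 0 w).neg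
  · rw [stepDiff_of_nonpos hw]; exact key w 0

lemma integral_abs_stepDiff (w : ℝ) : ∫ t, |stepDiff w t| = |w| := by
  have key : ∀ a b : ℝ, a ≤ b → ∫ t, |(Set.Ico a b).indicator (1 : ℝ → ℝ) t| = b - a := by
    intro a b hab
    have : (fun t => |(Set.Ico a b).indicator (1 : ℝ → ℝ) t|) = (Set.Ico a b).indicator 1 := by
      funext t; by_cases h : t ∈ Set.Ico a b <;> simp [h]
    rw [this, integral_indicator_one measurableSet_Ico]
    simp [hab]
  rcases le_total 0 w with hw | hw
  · rw [stepDiff_of_nonneg hw]; simp only [abs_neg]; rw [key 0 w hw, abs_of_nonneg hw]; ring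
  · rw [stepDiff_of_nonpos hw, key w 0 hw, abs_of_nonpos hw]; ring

lemma integral_mul_stepDiff {s : ℝ → ℝ} (w : ℝ) :
    ∫ t, s t * stepDiff w t = -∫ t in (0 : ℝ)..w, s t := by
  have key : ∀ a b : ℝ, ∫ t, s t * (Set.Ico a b).indicator (1 : ℝ → ℝ) t
      = ∫ t in Set.Ioc a b, s t := by
    intro a b
    have : (fun t => s t * (Set.Ico a b).indicator (1 : ℝ → ℝ) t) = (Set.Ico a b).indicator s := by
      funext t; by_cases h : t ∈ Set.Ico a b <;> simp [h]
    rw [this, integral_indicator measurableSet_Ico, integral_Ico_eq_integral_Ioc]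
  rcases le_total 0 w with hw | hw
  · rw [stepDiff_of_nonneg hw, intervalIntegral.integral_of_le hw]
    simp only [mul_neg, integral_neg, key]
  · rw [stepDiff_of_nonpos hw, intervalIntegral.integral_of_ge hw, key, neg_neg]

lemma integrable_prod_mul_stepDiff (μ : Measure ℝ) [IsProbabilityMeasure μ]
    (hμ : Integrable id μ) {s : ℝ → ℝ} (hs : Measurable s) (hs1 : ∀ t, |s t| ≤ 1) :
    Integrable (fun p : ℝ × ℝ => s p.2 * stepDiff p.1 p.2) (μ.prod volume) := by
  have hm : Measurable fun p : ℝ × ℝ => s p.2 * stepDiff p.1 p.2 :=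
    (hs.comp measurable_snd).mul measurable_uncurry_stepDiff
  have hint : ∀ w, Integrable fun t => s t * stepDiff w t := fun w =>
    (integrable_stepDiff w).bdd_mul hs.aestronglyMeasurable (Filter.Eventually.of_forall hs1)
  refine (integrable_prod_iff hm.aestronglyMeasurable).2 ⟨Filter.Eventually.of_forall hint, ?_⟩
  refine Integrable.mono' hμ.abs
    hm.norm.stronglyMeasurable.integral_prod_right.aestronglyMeasurable
    (Filter.Eventually.of_forall fun w => ?_)
  rw [Real.norm_of_nonneg (integral_nonneg fun _ => norm_nonneg _), id, ← integral_abs_stepDiff w]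
  refine integral_mono (hint w).norm (integrable_stepDiff w).abs fun t => ?_
  simp only [norm_mul, Real.norm_eq_abs]
  exact mul_le_of_le_one_left (abs_nonneg _) (hs1 t)

lemma integral_stepDiff_left (μ : Measure ℝ) [IsProbabilityMeasure μ] (t : ℝ) :
    ∫ w, stepDiff w t ∂μ = μ.real (Set.Iic t) - (Set.Ici (0 : ℝ)).indicator 1 t := by
  have h1 : (fun w => (Set.Ici w).indicator (1 : ℝ → ℝ) t) = (Set.Iic t).indicator 1 := by
    funext w; simp [Set.indicator_apply]
  have hi : Integrable ((Set.Iic t).indicator (1 : ℝ → ℝ)) μ :=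
    (integrable_const (1 : ℝ)).indicator measurableSet_Iic
  simp only [stepDiff]
  rw [integral_sub (by rw [h1]; exact hi) (integrable_const _), h1,
    integral_indicator_one measurableSet_Iic]
  simp

/-- Integration by parts: the integral of the primitive `-∫ t in 0..w, s t` of a bounded
weight is expressed by the distribution function. -/
lemma integral_primitive_eq (μ : Measure ℝ) [IsProbabilityMeasure μ]
    (hμ : Integrable id μ) {s : ℝ → ℝ} (hs : Measurable s) (hs1 : ∀ t, |s t| ≤ 1) :
    Integrable (fun t => s t * (μ.real (Set.Iic t) - (Set.Ici (0 : ℝ)).indicator 1 t)) ∧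
    ∫ w, (-∫ t in (0 : ℝ)..w, s t) ∂μ =
      ∫ t, s t * (μ.real (Set.Iic t) - (Set.Ici (0 : ℝ)).indicator 1 t) := by
  have hI := integrable_prod_mul_stepDiff μ hμ hs hs1
  have he : ∀ t, ∫ w, s t * stepDiff w t ∂μ =
      s t * (μ.real (Set.Iic t) - (Set.Ici (0 : ℝ)).indicator 1 t) := fun t => by
    rw [integral_const_mul, integral_stepDiff_left]
  refine ⟨?_, ?_⟩
  · have := hI.integral_prod_right
    simpa only [he] using this
  · simp only [← integral_mul_stepDiff, ← he]
    exact integral_integral_swap hI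

/-- The supremum over `1`-Lipschitz functions in the dual description of `d1` is attained, at the
primitive of the sign of the difference of the distribution functions. -/
lemma exists_lipschitz_d1_eq (μ ν : Measure ℝ) [IsProbabilityMeasure μ] [IsProbabilityMeasure ν]
    (hμ : Integrable id μ) (hν : Integrable id ν) :
    ∃ h : ℝ → ℝ, LipschitzWith 1 h ∧
      d1 μ ν = ENNReal.ofReal (∫ x, h x ∂μ - ∫ x, h x ∂ν) := by
  set D : ℝ → ℝ := fun t => μ.real (Set.Iic t) - ν.real (Set.Iic t) with hD
  have hmono : ∀ ρ : Measure ℝ, [IsProbabilityMeasure ρ] →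
      Measurable fun t => ρ.real (Set.Iic t) := fun ρ _ =>
    Monotone.measurable fun a b hab => measureReal_mono (Set.Iic_subset_Iic.2 hab)
  have hDm : Measurable D := (hmono μ).sub (hmono ν)
  set s : ℝ → ℝ := fun t => if 0 ≤ D t then 1 else -1 with hs
  have hsm : Measurable s :=
    Measurable.ite (measurableSet_le measurable_const hDm) measurable_const measurable_const
  have hs1 : ∀ t, |s t| ≤ 1 := fun t => by simp only [hs]; split_ifs <;> simp
  have hsD : ∀ t, s t * D t = |D t| := fun t => by
    simp only [hs]; split_ifs with h
    · rw [abs_of_nonneg h, one_mul]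
    · rw [abs_of_neg (not_le.1 h), neg_one_mul]
  obtain ⟨i1, e1⟩ := integral_primitive_eq μ hμ hsm hs1
  obtain ⟨i2, e2⟩ := integral_primitive_eq ν hν hsm hs1
  have hdiff : ∀ t, s t * (μ.real (Set.Iic t) - (Set.Ici (0 : ℝ)).indicator 1 t) -
      s t * (ν.real (Set.Iic t) - (Set.Ici (0 : ℝ)).indicator 1 t) = |D t| := fun t => by
    rw [← hsD]; simp only [hD]; ring
  have hloc : ∀ a b, IntervalIntegrable s volume a b := fun a b =>
    (intervalIntegrable_const (c := (1 : ℝ))).mono_fun hsm.aestronglyMeasurable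
      (Filter.Eventually.of_forall fun t => by simpa using hs1 t)
  refine ⟨fun w => -∫ t in (0 : ℝ)..w, s t, ?_, ?_⟩
  · refine LipschitzWith.of_dist_le_mul fun x y => ?_
    rw [Real.dist_eq, Real.dist_eq, neg_sub_neg,
      intervalIntegral.integral_interval_sub_left (hloc _ _) (hloc _ _)]
    have := intervalIntegral.norm_integral_le_of_norm_le_const (a := x) (b := y) (f := s) (C := 1)
      fun t _ => hs1 t
    rw [Real.norm_eq_abs, abs_sub_comm] at this
    simpa using this
  · rw [e1, e2, ← integral_sub i1 i2]
    simp only [hdiff]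
    rw [ofReal_integral_eq_lintegral_ofReal _ (Filter.Eventually.of_forall fun t => abs_nonneg _)]
    · rfl
    · exact (i1.sub i2).congr (Filter.Eventually.of_forall hdiff)

lemma integrable_of_lipschitzWith_one {μ : Measure ℝ} [IsProbabilityMeasure μ]
    (hμ : Integrable id μ) {h : ℝ → ℝ} (hh : LipschitzWith 1 h) : Integrable h μ := by
  refine Integrable.mono' (hμ.abs.add (integrable_const |h 0|))
    hh.continuous.measurable.aestronglyMeasurable (Filter.Eventually.of_forall fun x => ?_)
  have := hh.dist_le_mul x 0
  simp only [Real.dist_eq, NNReal.coe_one, one_mul, sub_zero] at this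
  have h2 := abs_sub_abs_le_abs_sub (h x) (h 0)
  simp only [Pi.add_apply, id, Real.norm_eq_abs]
  linarith

/-- A `1`-Lipschitz function is uniformly close to a `C¹` function with derivative at most `1`,
namely to its moving average over intervals of length `ε`. -/
lemma exists_C1_near {h : ℝ → ℝ} (hh : LipschitzWith 1 h) {ε : ℝ} (hε : 0 < ε) :
    ∃ g g' : ℝ → ℝ, (∀ x, HasDerivAt g (g' x) x) ∧ Continuous g' ∧ (∀ x, |g' x| ≤ 1) ∧
      ∀ x, |g x - h x| ≤ ε := by
  have hc := hh.continuous
  have hi : ∀ a b, IntervalIntegrable h volume a b := fun a b => hc.intervalIntegrable a b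
  refine ⟨fun x => ε⁻¹ * ((∫ t in (0 : ℝ)..(x + ε), h t) - ∫ t in (0 : ℝ)..x, h t),
    fun x => ε⁻¹ * (h (x + ε) - h x), fun x => ?_, by fun_prop, fun x => ?_, fun x => ?_⟩
  · have h1 : HasDerivAt (fun x => ∫ t in (0 : ℝ)..x, h t) (h x) x :=
      intervalIntegral.integral_hasDerivAt_right (hi _ _) (hc.stronglyMeasurableAtFilter _ _)
        hc.continuousAt
    have h2 : HasDerivAt (fun x => ∫ t in (0 : ℝ)..x, h t) (h (x + ε)) (x + ε) :=
      intervalIntegral.integral_hasDerivAt_right (hi _ _) (hc.stronglyMeasurableAtFilter _ _)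
        hc.continuousAt
    exact ((h2.comp_add_const x ε).sub h1).const_mul _
  · have := hh.dist_le_mul (x + ε) x
    simp only [Real.dist_eq, NNReal.coe_one, one_mul, add_sub_cancel_left, abs_of_pos hε] at this
    rw [abs_mul, abs_of_pos (inv_pos.2 hε), inv_mul_le_iff₀ hε]
    simpa using this
  · beta_reduce
    rw [intervalIntegral.integral_interval_sub_left (hi _ _) (hi _ _)]
    have e : ε⁻¹ * (∫ t in x..(x + ε), h t) - h x = ε⁻¹ * ∫ t in x..(x + ε), (h t - h x) := by
      rw [intervalIntegral.integral_sub (hi _ _) (by simp), intervalIntegral.integral_const,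
        smul_eq_mul, add_sub_cancel_left]
      field_simp
    rw [e, abs_mul, abs_of_pos (inv_pos.2 hε), inv_mul_le_iff₀ hε]
    have := intervalIntegral.norm_integral_le_of_norm_le_const (a := x) (b := x + ε)
      (f := fun t => h t - h x) (C := ε) fun t ht => by
        rw [Set.uIoc_of_le (by linarith)] at ht
        have := hh.dist_le_mul t x
        simp only [Real.dist_eq, NNReal.coe_one, one_mul] at this
        rw [abs_of_pos (a := t - x) (by linarith [ht.1])] at this
        rw [Real.norm_eq_abs]
        linarith [ht.2]
    simpa [abs_of_pos hε] using this

lemma lipschitzWith_one_of_deriv {g g' : ℝ → ℝ} (hg : ∀ x, HasDerivAt g (g' x) x)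
    (hg' : ∀ x, |g' x| ≤ 1) : LipschitzWith 1 g :=
  lipschitzWith_of_nnnorm_deriv_le (fun x => (hg x).differentiableAt) fun x => by
    rw [(hg x).deriv, ← NNReal.coe_le_coe]; simpa using hg' x

/-- Kantorovich duality on the line: `d1` is controlled by test functions of class `C¹` whose
derivative is at most `1`. -/
theorem d1_le_of_forall_C1 (μ ν : Measure ℝ) [IsProbabilityMeasure μ] [IsProbabilityMeasure ν]
    (hμ : Integrable id μ) (hν : Integrable id ν) {c : ℝ}
    (H : ∀ g g' : ℝ → ℝ, (∀ x, HasDerivAt g (g' x) x) → Continuous g' → (∀ x, |g' x| ≤ 1) →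
      ∫ x, g x ∂μ - ∫ x, g x ∂ν ≤ c) :
    d1 μ ν ≤ ENNReal.ofReal c := by
  obtain ⟨h, hh, e⟩ := exists_lipschitz_d1_eq μ ν hμ hν
  rw [e]
  refine ENNReal.ofReal_le_ofReal (le_of_forall_pos_le_add fun ε hε => ?_)
  obtain ⟨g, g', h1, h2, h3, h4⟩ := exists_C1_near hh (half_pos hε)
  have hg := lipschitzWith_one_of_deriv h1 h3
  have close : ∀ ρ : Measure ℝ, [IsProbabilityMeasure ρ] → Integrable id ρ →
      |∫ x, g x ∂ρ - ∫ x, h x ∂ρ| ≤ ε / 2 := by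
    intro ρ _ hρ
    rw [← integral_sub (integrable_of_lipschitzWith_one hρ hg) (integrable_of_lipschitzWith_one hρ hh)]
    simpa using norm_integral_le_of_norm_le_const (μ := ρ) (f := fun x => g x - h x)
      (Filter.Eventually.of_forall h4)
  have c1 := abs_le.1 (close μ hμ)
  have c2 := abs_le.1 (close ν hν)
  linarith [H g g' h1 h2 h3, c1.1, c1.2, c2.1, c2.2]

/-! ### Stein's equation -/

/-- The unnormalized standard Gaussian density. -/
noncomputable def gaussKer (x : ℝ) : ℝ := Real.exp (-(1 / 2) * x ^ 2)

lemma gaussKer_pos (x : ℝ) : 0 < gaussKer x := Real.exp_pos _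

lemma hasDerivAt_gaussKer (x : ℝ) : HasDerivAt gaussKer (-x * gaussKer x) x := by
  have h := (((hasDerivAt_id x).pow 2).const_mul (-(1 / 2) : ℝ)).exp
  refine h.congr_deriv ?_
  simp [gaussKer]; ring

lemma continuous_gaussKer : Continuous gaussKer := by unfold gaussKer; fun_prop

lemma integrable_gaussKer : Integrable gaussKer := integrable_exp_neg_mul_sq (by norm_num)

lemma integrable_id_mul_gaussKer : Integrable fun x => x * gaussKer x :=
  integrable_mul_exp_neg_mul_sq (by norm_num)

lemma tendsto_linear_mul_gaussKer (a b : ℝ) :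
    Filter.Tendsto (fun x => (a * |x| + b) * gaussKer x) (Filter.cocompact ℝ) (nhds 0) := by
  have h1 := tendsto_rpow_abs_mul_exp_neg_mul_sq_cocompact (a := 1 / 2) (by norm_num) 1
  have h0 := tendsto_rpow_abs_mul_exp_neg_mul_sq_cocompact (a := 1 / 2) (by norm_num) 0
  have h := (h1.const_mul a).add (h0.const_mul b)
  simp only [Real.rpow_one, Real.rpow_zero, one_mul, mul_zero, add_zero] at h
  refine h.congr fun x => ?_
  rw [gaussKer]; ring

lemma integrable_mul_gaussKer {k : ℝ → ℝ} (hk : Continuous k) {a b : ℝ}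
    (hb : ∀ x, |k x| ≤ a * |x| + b) : Integrable fun x => k x * gaussKer x := by
  refine Integrable.mono' ((integrable_id_mul_gaussKer.abs.const_mul a).add
    (integrable_gaussKer.const_mul b)) (hk.mul continuous_gaussKer).aestronglyMeasurable
    (Filter.Eventually.of_forall fun x => ?_)
  have := mul_le_mul_of_nonneg_right (hb x) (gaussKer_pos x).le
  rw [Real.norm_eq_abs, abs_mul, abs_of_pos (gaussKer_pos x)]
  simp only [Pi.add_apply, abs_mul, abs_of_pos (gaussKer_pos x)]
  linarith

lemma setIntegral_Iic_id_mul_gaussKer (w : ℝ) :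
    ∫ x in Set.Iic w, x * gaussKer x = -gaussKer w := by
  have h := integral_Iic_of_hasDerivAt_of_tendsto' (a := w) (f := fun x => -gaussKer x)
    (f' := fun x => x * gaussKer x) (m := 0)
    (fun x _ => (hasDerivAt_gaussKer x).neg.congr_deriv (by ring))
    integrable_id_mul_gaussKer.integrableOn (by
      have := (tendsto_linear_mul_gaussKer 0 1).mono_left atBot_le_cocompact
      simpa using this.neg)
  simpa using h

lemma integral_id_mul_gaussKer : ∫ x, x * gaussKer x = 0 := by
  have h := integral_neg_eq_self (fun x => x * gaussKer x) (volume : Measure ℝ)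
  have e : ∀ x : ℝ, -x * gaussKer (-x) = -(x * gaussKer x) := fun x => by
    simp [gaussKer]
  simp only [e, integral_neg] at h
  linarith

lemma integral_mul_gaussKer_eq_zero {k : ℝ → ℝ} (h : ∫ x, k x ∂(gaussianReal 0 1) = 0) :
    ∫ x, k x * gaussKer x = 0 := by
  rw [integral_gaussianReal_eq_integral_smul one_ne_zero] at h
  have e : ∀ x, gaussianPDFReal 0 1 x • k x = (√(2 * Real.pi))⁻¹ * (k x * gaussKer x) := by
    intro x
    simp only [gaussianPDFReal, gaussKer, NNReal.coe_one, smul_eq_mul, mul_one, sub_zero]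
    rw [show -x ^ 2 / 2 = -(1 / 2) * x ^ 2 by ring]; ring
  simp only [e, integral_const_mul] at h
  exact (mul_eq_zero.1 h).resolve_left (by positivity)

/-- A monotone function with Gaussian mean zero has nonpositive integral over every left
half-line: it changes sign once, from negative to positive. -/
lemma setIntegral_Iic_nonpos_of_monotone {k : ℝ → ℝ} (hk : Monotone k)
    (hi : Integrable fun x => k x * gaussKer x) (h0 : ∫ x, k x * gaussKer x = 0) (w : ℝ) :
    ∫ x in Set.Iic w, k x * gaussKer x ≤ 0 := by
  rcases le_total (k w) 0 with h | h
  · exact setIntegral_nonpos measurableSet_Iic fun x hx =>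
      mul_nonpos_of_nonpos_of_nonneg ((hk hx).trans h) (gaussKer_pos x).le
  · have h1 : 0 ≤ ∫ x in Set.Ioi w, k x * gaussKer x :=
      setIntegral_nonneg measurableSet_Ioi fun x hx =>
        mul_nonneg (h.trans (hk (le_of_lt hx))) (gaussKer_pos x).le
    have h2 := intervalIntegral.integral_Iic_add_Ioi (b := w) hi.integrableOn hi.integrableOn
    linarith

/-- The solution of Stein's equation `f' w - w * f w = k w` that is bounded when `k` is Lipschitz
with Gaussian mean zero. -/
noncomputable def steinSol (k : ℝ → ℝ) (w : ℝ) : ℝ :=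
  Real.exp (1 / 2 * w ^ 2) * ∫ x in Set.Iic w, k x * gaussKer x

lemma exp_mul_gaussKer (w : ℝ) : Real.exp (1 / 2 * w ^ 2) * gaussKer w = 1 := by
  rw [gaussKer, ← Real.exp_add]; simp

lemma hasDerivAt_steinSol {k : ℝ → ℝ} (hk : Continuous k)
    (hi : Integrable fun x => k x * gaussKer x) (w : ℝ) :
    HasDerivAt (steinSol k) (w * steinSol k w + k w) w := by
  have hc : Continuous fun x => k x * gaussKer x := hk.mul continuous_gaussKer
  have h1 : HasDerivAt (fun w => ∫ x in Set.Iic w, k x * gaussKer x) (k w * gaussKer w) w := by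
    have h := (intervalIntegral.integral_hasDerivAt_right (hc.intervalIntegrable 0 w)
      (hc.stronglyMeasurableAtFilter _ _) hc.continuousAt).const_add
      (∫ x in Set.Iic (0 : ℝ), k x * gaussKer x)
    refine h.congr_of_eventuallyEq (Filter.Eventually.of_forall fun v => ?_)
    have := intervalIntegral.integral_Iic_sub_Iic (a := 0) (b := v) hi.integrableOn hi.integrableOn
    simp only [← this]; ring
  have h2 : HasDerivAt (fun w : ℝ => Real.exp (1 / 2 * w ^ 2)) (w * Real.exp (1 / 2 * w ^ 2)) w := by
    have h := (((hasDerivAt_id w).pow 2).const_mul (1 / 2 : ℝ)).exp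
    refine h.congr_deriv ?_
    simp; ring
  refine (h2.mul h1).congr_deriv ?_
  rw [steinSol]
  linear_combination k w * exp_mul_gaussKer w

lemma abs_steinSol_le_one {k : ℝ → ℝ} (hk : LipschitzWith 1 k)
    (hi : Integrable fun x => k x * gaussKer x) (h0 : ∫ x, k x * gaussKer x = 0) (w : ℝ) :
    |steinSol k w| ≤ 1 := by
  have lip : ∀ x y, |k x - k y| ≤ |x - y| := fun x y => by
    simpa [Real.dist_eq] using hk.dist_le_mul x y
  have hx := integrable_id_mul_gaussKer
  have m1 : Monotone fun x => x + k x := fun x y hxy => by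
    have := abs_le.1 (lip x y); rw [abs_of_nonpos (sub_nonpos.2 hxy)] at this
    simp only; linarith [this.2]
  have m2 : Monotone fun x => x - k x := fun x y hxy => by
    have := abs_le.1 (lip x y); rw [abs_of_nonpos (sub_nonpos.2 hxy)] at this
    simp only; linarith [this.1]
  have b1 := setIntegral_Iic_nonpos_of_monotone m1 (by simp only [add_mul]; exact hx.add hi)
    (by simp only [add_mul]; rw [integral_add hx hi, integral_id_mul_gaussKer, h0, add_zero]) w
  have b2 := setIntegral_Iic_nonpos_of_monotone m2 (by simp only [sub_mul]; exact hx.sub hi)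
    (by simp only [sub_mul]; rw [integral_sub hx hi, integral_id_mul_gaussKer, h0, sub_zero]) w
  simp only [add_mul] at b1
  simp only [sub_mul] at b2
  rw [integral_add hx.integrableOn hi.integrableOn, setIntegral_Iic_id_mul_gaussKer] at b1
  rw [integral_sub hx.integrableOn hi.integrableOn, setIntegral_Iic_id_mul_gaussKer] at b2
  have e := exp_mul_gaussKer w
  have p := Real.exp_pos (1 / 2 * w ^ 2)
  rw [steinSol, abs_le]
  constructor <;> nlinarith

/-- Comparison for `p' = w p + φ` with `|φ| ≤ c`: on `(0, ∞)` the function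
`(c / w - p) * exp (-w² / 2)` decreases to zero. -/
lemma mul_le_of_hasDerivAt_ou {p φ : ℝ → ℝ} {a b c : ℝ}
    (hp : ∀ w, HasDerivAt p (w * p w + φ w) w) (hφ : ∀ w, |φ w| ≤ c)
    (hb : ∀ w, |p w| ≤ a * |w| + b) {w : ℝ} (hw : 0 < w) : w * p w ≤ c := by
  have hc : 0 ≤ c := (abs_nonneg _).trans (hφ 0)
  set q : ℝ → ℝ := fun x => (c * x⁻¹ - p x) * gaussKer x with hq
  have hd : ∀ x, 0 < x → HasDerivAt q ((-(c * (x ^ 2)⁻¹) - c - φ x) * gaussKer x) x := by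
    intro x hx
    have h1 := ((hasDerivAt_inv hx.ne').const_mul c).sub (hp x)
    refine (h1.mul (hasDerivAt_gaussKer x)).congr_deriv ?_
    simp only [Pi.sub_apply]
    field_simp
    ring
  have anti : AntitoneOn q (Set.Ioi 0) := by
    refine antitoneOn_of_deriv_nonpos (convex_Ioi 0)
      (fun x hx => (hd x hx).continuousAt.continuousWithinAt)
      (fun x hx => ?_) (fun x hx => ?_) <;> rw [interior_Ioi] at hx
    · exact (hd x hx).differentiableAt.differentiableWithinAt
    · rw [(hd x hx).deriv]
      have h1 := (abs_le.1 (hφ x)).1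
      have h2 : 0 ≤ c * (x ^ 2)⁻¹ := by positivity
      exact mul_nonpos_of_nonpos_of_nonneg (by linarith) (gaussKer_pos x).le
  have lim : Filter.Tendsto (fun x => -((a * |x| + b) * gaussKer x)) Filter.atTop (nhds 0) := by
    simpa using ((tendsto_linear_mul_gaussKer a b).mono_left atTop_le_cocompact).neg
  have hqw : 0 ≤ q w := by
    refine le_of_tendsto lim ?_
    filter_upwards [Filter.eventually_ge_atTop w] with x hx
    have hx0 : 0 < x := hw.trans_le hx
    refine le_trans ?_ (anti hw hx0 hx)
    rw [← neg_mul]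
    refine mul_le_mul_of_nonneg_right ?_ (gaussKer_pos x).le
    have := (abs_le.1 (hb x)).2
    have : 0 ≤ c * x⁻¹ := by positivity
    linarith
  have h3 := nonneg_of_mul_nonneg_left hqw (gaussKer_pos w)
  have h4 : w * (c * w⁻¹) = c := by field_simp
  nlinarith

lemma abs_mul_le_of_hasDerivAt_ou {p φ : ℝ → ℝ} {a b c : ℝ}
    (hp : ∀ w, HasDerivAt p (w * p w + φ w) w) (hφ : ∀ w, |φ w| ≤ c)
    (hb : ∀ w, |p w| ≤ a * |w| + b) (w : ℝ) : |w * p w| ≤ c := by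
  have hc : 0 ≤ c := (abs_nonneg _).trans (hφ 0)
  have pos : ∀ {p φ : ℝ → ℝ}, (∀ w, HasDerivAt p (w * p w + φ w) w) → (∀ w, |φ w| ≤ c) →
      (∀ w, |p w| ≤ a * |w| + b) → ∀ w, 0 < w → |w * p w| ≤ c := by
    intro p φ hp hφ hb w hw
    refine abs_le.2 ⟨?_, mul_le_of_hasDerivAt_ou hp hφ hb hw⟩
    have := mul_le_of_hasDerivAt_ou (p := fun x => -p x) (φ := fun x => -φ x) (a := a) (b := b)
      (c := c) (fun x => (hp x).neg.congr_deriv (by ring)) (by simpa using hφ)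
      (by simpa using hb) hw
    linarith
  rcases lt_trichotomy w 0 with h | h | h
  · have := pos (p := fun x => p (-x)) (φ := fun x => -φ (-x))
      (fun x => ((hp (-x)).scomp x (hasDerivAt_neg x)).congr_deriv (by simp; ring))
      (fun x => by simpa using hφ (-x)) (fun x => by simpa using hb (-x)) (-w) (by linarith)
    simpa using this
  · simpa [h] using hc
  · exact pos hp hφ hb w h

lemma integrable_id_gaussianReal : Integrable id (gaussianReal 0 1) :=
  memLp_one_iff_integrable.1 (memLp_id_gaussianReal 1)

lemma integral_abs_gaussianReal_le_one : ∫ x, |x| ∂(gaussianReal 0 1) ≤ 1 := by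
  have h2 : Integrable (fun x : ℝ => x ^ 2) (gaussianReal 0 1) :=
    (memLp_id_gaussianReal 2).integrable_sq
  have hv : ∫ x : ℝ, x ^ 2 ∂(gaussianReal 0 1) = 1 := by
    have := variance_id_gaussianReal (μ := 0) (v := 1)
    rw [variance_eq_integral measurable_id.aemeasurable] at this
    simpa using this
  have := integral_mono integrable_id_gaussianReal.abs ((h2.add (integrable_const 1)).div_const 2)
    fun x => show |x| ≤ (x ^ 2 + 1) / 2 by nlinarith [sq_nonneg (|x| - 1), sq_abs x]
  simp only [id] at this
  refine this.trans ?_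
  rw [integral_div]
  simp only [Pi.add_apply]
  rw [integral_add h2 (integrable_const 1), hv]
  simp

lemma abs_sub_integral_gaussianReal_le {h : ℝ → ℝ} (hh : LipschitzWith 1 h) (w : ℝ) :
    |h w - ∫ x, h x ∂(gaussianReal 0 1)| ≤ |w| + 1 := by
  have hi := integrable_of_lipschitzWith_one integrable_id_gaussianReal hh
  have e : h w - ∫ x, h x ∂(gaussianReal 0 1) = ∫ x, (h w - h x) ∂(gaussianReal 0 1) := by
    rw [integral_sub (integrable_const _) hi]; simp
  rw [e]
  refine (abs_integral_le_integral_abs).trans ?_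
  have hm := integral_mono ((integrable_const (h w)).sub hi).abs
    ((integrable_const |w|).add integrable_id_gaussianReal.abs) fun x => by
      have h1 := hh.dist_le_mul w x
      simp only [Real.dist_eq, NNReal.coe_one, one_mul] at h1
      simp only [Pi.add_apply, Pi.sub_apply, id]
      exact h1.trans (abs_sub _ _)
  refine hm.trans ?_
  simp only [Pi.add_apply, id]
  rw [integral_add (integrable_const _) (by exact integrable_id_gaussianReal.abs)]
  have := integral_abs_gaussianReal_le_one
  simpa using this

/-- Stein's equation for a `C¹` test function with derivative at most `1`. The bounds `2.8` and `4`
are not the optimal `√(2/π)` and `2`. -/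
theorem exists_stein_solution {h h' : ℝ → ℝ} (hd : ∀ x, HasDerivAt h (h' x) x)
    (hb : ∀ x, |h' x| ≤ 1) :
    ∃ f p : ℝ → ℝ, (∀ w, HasDerivAt f (p w) w) ∧ LipschitzWith 4 p ∧
      (∀ w, |f w| ≤ 1) ∧ (∀ w, |p w| ≤ 2.8) ∧
      ∀ w, p w - w * f w = h w - ∫ x, h x ∂(gaussianReal 0 1) := by
  set N := ∫ x, h x ∂(gaussianReal 0 1) with hN
  have hh := lipschitzWith_one_of_deriv hd hb
  set k : ℝ → ℝ := fun x => h x - N with hk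
  have hkd : ∀ x, HasDerivAt k (h' x) x := fun x => (hd x).sub_const N
  have hkl := lipschitzWith_one_of_deriv hkd hb
  have hkb : ∀ x, |k x| ≤ |x| + 1 := abs_sub_integral_gaussianReal_le hh
  have hi := integrable_mul_gaussKer hkl.continuous (a := 1) (b := 1) (by simpa using hkb)
  have h0 : ∫ x, k x * gaussKer x = 0 := by
    refine integral_mul_gaussKer_eq_zero ?_
    simp only [hk]
    rw [integral_sub (integrable_of_lipschitzWith_one integrable_id_gaussianReal hh)
      (integrable_const _)]
    simp [hN]
  set f := steinSol k with hf
  have f1 : ∀ w, |f w| ≤ 1 := abs_steinSol_le_one hkl hi h0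
  have fd : ∀ w, HasDerivAt f (w * f w + k w) w := hasDerivAt_steinSol hkl.continuous hi
  set p : ℝ → ℝ := fun w => w * f w + k w with hp
  have pd : ∀ w, HasDerivAt p (w * p w + (f w + h' w)) w := fun w =>
    (((hasDerivAt_id w).mul (fd w)).add (hkd w)).congr_deriv (by simp [hp]; ring)
  have φb : ∀ w, |f w + h' w| ≤ 2 := fun w =>
    (abs_add_le _ _).trans (by linarith [f1 w, hb w])
  have pb : ∀ w, |p w| ≤ 2 * |w| + 1 := fun w => by
    refine (abs_add_le _ _).trans ?_
    rw [abs_mul]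
    nlinarith [f1 w, hkb w, abs_nonneg w]
  have wp := abs_mul_le_of_hasDerivAt_ou pd φb pb
  refine ⟨f, p, fd, ?_, f1, fun w => ?_, fun w => by simp [hp, hk]⟩
  · refine lipschitzWith_of_nnnorm_deriv_le (fun x => (pd x).differentiableAt) fun x => ?_
    rw [(pd x).deriv, ← NNReal.coe_le_coe, coe_nnnorm, Real.norm_eq_abs]
    refine (abs_add_le _ _).trans ?_
    exact (add_le_add (wp x) (φb x)).trans (by norm_num)
  -- The linear bound is used for `|w| ≤ 3 / 4`, the bound `2 / |w|` otherwise.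
  · have h1 := wp w
    have h2 := pb w
    rw [abs_mul] at h1
    rcases le_total |w| (3 / 4) with h3 | h3
    · linarith
    · nlinarith [abs_nonneg (p w)]

/-! ### Stein's method for sums of dependent variables -/

/-- First order Taylor estimate for a function with `M`-Lipschitz derivative. -/
lemma abs_taylor_le {f p : ℝ → ℝ} (hf : ∀ w, HasDerivAt f (p w) w) {M : ℝ≥0}
    (hp : LipschitzWith M p) (x t : ℝ) : |f (x + t) - f x - t * p x| ≤ M / 2 * t ^ 2 := by
  have lip : ∀ u, |p (x + u) - p x| ≤ M * |u| := fun u => by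
    simpa [Real.dist_eq] using hp.dist_le_mul (x + u) x
  have hd : ∀ u, HasDerivAt (fun u => f (x + u) - f x - u * p x) (p (x + u) - p x) u := fun u =>
    ((((hf (x + u)).comp_const_add x u).sub_const (f x)).sub
      ((hasDerivAt_id u).mul_const (p x))).congr_deriv (by simp)
  have hq : ∀ u : ℝ, HasDerivAt (fun u : ℝ => M / 2 * u ^ 2) (M * u) u := fun u =>
    (((hasDerivAt_id u).pow 2).const_mul (M / 2 : ℝ)).congr_deriv (by simp; ring)
  -- Both signs `ε` of the Taylor remainder: compare derivatives on each half-line.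
  have up : ∀ ε : ℝ, |ε| = 1 → ε * (f (x + t) - f x - t * p x) ≤ M / 2 * t ^ 2 := by
    intro ε hε
    set g : ℝ → ℝ := fun u => M / 2 * u ^ 2 - ε * (f (x + u) - f x - u * p x) with hg
    have gd : ∀ u, HasDerivAt g (M * u - ε * (p (x + u) - p x)) u := fun u =>
      (hq u).sub ((hd u).const_mul ε)
    have gb : ∀ u, |ε * (p (x + u) - p x)| ≤ M * |u| := fun u => by
      rw [abs_mul, hε, one_mul]; exact lip u
    have gc : Continuous g := continuous_iff_continuousAt.2 fun u => (gd u).continuousAt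
    have g0 : g 0 = 0 := by simp [hg]
    have : 0 ≤ g t := by
      rcases le_total 0 t with ht | ht
      · have mono : MonotoneOn g (Set.Ici 0) := by
          refine monotoneOn_of_deriv_nonneg (convex_Ici 0) gc.continuousOn
            (fun u _ => (gd u).differentiableAt.differentiableWithinAt) fun u hu => ?_
          rw [interior_Ici] at hu
          rw [(gd u).deriv]
          have := (abs_le.1 (gb u)).2
          rw [abs_of_pos hu] at this; linarith
        rw [← g0]; exact mono Set.self_mem_Ici ht ht
      · have anti : AntitoneOn g (Set.Iic 0) := by
          refine antitoneOn_of_deriv_nonpos (convex_Iic 0) gc.continuousOn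
            (fun u _ => (gd u).differentiableAt.differentiableWithinAt) fun u hu => ?_
          rw [interior_Iic] at hu
          rw [(gd u).deriv]
          have := (abs_le.1 (gb u)).1
          rw [abs_of_neg hu] at this; linarith
        rw [← g0]; exact anti ht Set.self_mem_Iic ht
    simp only [hg] at this; linarith
  rw [abs_le]
  have h1 := up 1 (by simp)
  have h2 := up (-1) (by simp)
  constructor <;> linarith

/-- The square, made globally Lipschitz by clamping its argument to `[-B, B]`. -/
noncomputable def clampSq (B x : ℝ) : ℝ := (max (-B) (min B x)) ^ 2

lemma clampSq_of_abs_le {B x : ℝ} (h : |x| ≤ B) : clampSq B x = x ^ 2 := by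
  rw [clampSq, min_eq_right (abs_le.1 h).2, max_eq_right (abs_le.1 h).1]

lemma lipschitzWith_clampSq (B : ℝ≥0) : LipschitzWith (2 * B) (clampSq B) := by
  refine LipschitzWith.of_dist_le_mul fun x y => ?_
  have hl : LipschitzWith 1 fun x : ℝ => max (-(B : ℝ)) (min B x) :=
    (LipschitzWith.id.const_min _).const_max _
  have h1 := hl.dist_le_mul x y
  have bd : ∀ x : ℝ, |max (-(B : ℝ)) (min B x)| ≤ B := fun x =>
    abs_le.2 ⟨le_max_left _ _, max_le (by linarith [B.2]) (min_le_left _ _)⟩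
  simp only [Real.dist_eq, NNReal.coe_one, one_mul, NNReal.coe_mul, NNReal.coe_ofNat] at h1 ⊢
  rw [clampSq, clampSq, sq_sub_sq, abs_mul]
  refine mul_le_mul ?_ h1 (abs_nonneg _) (by positivity)
  exact (abs_add_le _ _).trans (by linarith [bd x, bd y])

lemma covariance_congr_left {Ω : Type*} [MeasurableSpace Ω] {P : Measure Ω}
    {X X' Y : Ω → ℝ} (h : X =ᵐ[P] X') :
    covariance X Y P = covariance X' Y P := by
  rw [covariance, covariance, integral_congr_ae h]
  exact integral_congr_ae (h.mono fun ω hω => by simp only [hω])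

section Sums

variable {Ω : Type*} [MeasurableSpace Ω] {P : Measure Ω} [IsProbabilityMeasure P]

/-- The contribution of one summand `ξ` to `E[W f(W)]`, where `W = V + ξ`. The covariance hypothesis
replaces the independence of `ξ` and `V`. -/
lemma abs_integral_mul_sub_le {ξ V : Ω → ℝ} (hξ : AEMeasurable ξ P) (hV : AEMeasurable V P)
    {B M F : ℝ≥0} (hB : ∀ᵐ ω ∂P, |ξ ω| ≤ B) (h0 : ∫ ω, ξ ω ∂P = 0)
    (h1 : ∫ ω, |ξ ω| ∂P ≤ B / 2)
    (hcov : ∀ (φ ψ : ℝ → ℝ) (L L' : ℝ≥0), LipschitzWith L φ → LipschitzWith L' ψ →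
      |covariance (fun ω => φ (ξ ω)) (fun ω => ψ (V ω)) P| ≤ -(L * L' * covariance ξ V P))
    {f p : ℝ → ℝ} (hf : ∀ w, HasDerivAt f (p w) w) (hp : LipschitzWith M p) {c : ℝ}
    (hfb : ∀ w, |f w| ≤ c) (hpb : ∀ w, |p w| ≤ F) :
    |∫ ω, ξ ω * f (V ω + ξ ω) ∂P - (∫ ω, ξ ω ^ 2 ∂P) * ∫ ω, p (V ω + ξ ω) ∂P| ≤
      (F + 2 * B * M) * (-covariance ξ V P) + M * B * ∫ ω, ξ ω ^ 2 ∂P := by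
  have hfl : LipschitzWith F f :=
    lipschitzWith_of_nnnorm_deriv_le (fun x => (hf x).differentiableAt) fun x => by
      rw [(hf x).deriv, ← NNReal.coe_le_coe]; simpa using hpb x
  have fm := hfl.continuous.measurable
  have pm := hp.continuous.measurable
  have mfV : AEMeasurable (fun ω => f (V ω)) P := fm.comp_aemeasurable hV
  have mpV : AEMeasurable (fun ω => p (V ω)) P := pm.comp_aemeasurable hV
  have mfW : AEMeasurable (fun ω => f (V ω + ξ ω)) P := fm.comp_aemeasurable (hV.add hξ)
  have mpW : AEMeasurable (fun ω => p (V ω + ξ ω)) P := pm.comp_aemeasurable (hV.add hξ)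
  have top : ∀ {Y : Ω → ℝ} {b : ℝ}, AEMeasurable Y P → (∀ᵐ ω ∂P, |Y ω| ≤ b) → MemLp Y ⊤ P :=
    fun hY hb => memLp_top_of_bound hY.aestronglyMeasurable _ hb
  have tξ := top hξ hB
  have tfV := top mfV (Filter.Eventually.of_forall fun ω => hfb (V ω))
  have tpV := top mpV (Filter.Eventually.of_forall fun ω => hpb (V ω))
  have tfW := top mfW (Filter.Eventually.of_forall fun ω => hfb (V ω + ξ ω))
  have tpW := top mpW (Filter.Eventually.of_forall fun ω => hpb (V ω + ξ ω))
  have tξ2 : MemLp (fun ω => ξ ω ^ 2) ⊤ P := by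
    simp only [pow_two]; exact tξ.mul tξ
  have i1 : Integrable (fun ω => ξ ω * f (V ω + ξ ω)) P := (tfW.mul tξ).integrable le_top
  have i2 : Integrable (fun ω => ξ ω * f (V ω)) P := (tfV.mul tξ).integrable le_top
  have i3 : Integrable (fun ω => ξ ω ^ 2 * p (V ω)) P := (tpV.mul tξ2).integrable le_top
  have iξ2 : Integrable (fun ω => ξ ω ^ 2) P := tξ2.integrable le_top
  have ipV := tpV.integrable le_top
  have ipW := tpW.integrable le_top
  have iξ := tξ.integrable le_top
  set σ := ∫ ω, ξ ω ^ 2 ∂P with hσ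
  have σ0 : 0 ≤ σ := integral_nonneg fun _ => sq_nonneg _
  have e1 : |∫ ω, ξ ω * f (V ω + ξ ω) ∂P - ∫ ω, ξ ω * f (V ω) ∂P - ∫ ω, ξ ω ^ 2 * p (V ω) ∂P|
      ≤ M / 2 * B * σ := by
    rw [← integral_sub i1 i2, ← integral_sub (by exact i1.sub i2) i3, hσ, ← integral_const_mul]
    refine abs_integral_le_integral_abs.trans
      (integral_mono_ae ((i1.sub i2).sub i3).abs (iξ2.const_mul _) ?_)
    filter_upwards [hB] with ω hω
    have t := abs_taylor_le hf hp (V ω) (ξ ω)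
    have e : ξ ω * f (V ω + ξ ω) - ξ ω * f (V ω) - ξ ω ^ 2 * p (V ω) =
      ξ ω * (f (V ω + ξ ω) - f (V ω) - ξ ω * p (V ω)) := by ring
    simp only [e, abs_mul]
    calc _ ≤ (B : ℝ) * (M / 2 * ξ ω ^ 2) := mul_le_mul hω t (abs_nonneg _) B.2
      _ = _ := by ring
  have e2 : |∫ ω, ξ ω * f (V ω) ∂P| ≤ F * (-covariance ξ V P) := by
    have h := hcov id f 1 F LipschitzWith.id hfl
    simp only [id] at h
    rw [covariance_eq_sub (tξ.mono_exponent le_top) (tfV.mono_exponent le_top)] at h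
    simp only [h0, zero_mul, sub_zero, Pi.mul_apply, NNReal.coe_one, one_mul] at h
    linarith
  have e3 : |∫ ω, ξ ω ^ 2 * p (V ω) ∂P - σ * ∫ ω, p (V ω) ∂P| ≤
      2 * B * M * (-covariance ξ V P) := by
    have h := hcov (clampSq B) p (2 * B) M (lipschitzWith_clampSq B) hp
    have ae : (fun ω => clampSq B (ξ ω)) =ᵐ[P] fun ω => ξ ω ^ 2 := by
      filter_upwards [hB] with ω hω using clampSq_of_abs_le hω
    rw [covariance_congr_left ae,
      covariance_eq_sub (tξ2.mono_exponent le_top) (tpV.mono_exponent le_top)] at h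
    simp only [Pi.mul_apply, NNReal.coe_mul, NNReal.coe_ofNat] at h
    linarith
  have e4 : |σ * ∫ ω, p (V ω) ∂P - σ * ∫ ω, p (V ω + ξ ω) ∂P| ≤ M / 2 * B * σ := by
    rw [← mul_sub, abs_mul, abs_of_nonneg σ0, ← integral_sub ipV ipW]
    have : |∫ ω, (p (V ω) - p (V ω + ξ ω)) ∂P| ≤ M * ∫ ω, |ξ ω| ∂P := by
      rw [← integral_const_mul]
      refine abs_integral_le_integral_abs.trans
        (integral_mono (ipV.sub ipW).abs (iξ.abs.const_mul _) fun ω => ?_)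
      simpa [Real.dist_eq] using hp.dist_le_mul (V ω) (V ω + ξ ω)
    have h2 := mul_le_mul_of_nonneg_left h1 M.2
    calc _ ≤ σ * (M * (B / 2)) := mul_le_mul_of_nonneg_left (this.trans h2) σ0
      _ = _ := by ring
  rw [abs_le] at e1 e2 e3 e4 ⊢
  constructor <;> linarith [e1.1, e1.2, e2.1, e2.2, e3.1, e3.2, e4.1, e4.2]

/-- A centered random variable with values in an interval of length `B` is bounded by `B`, and its
first absolute moment is at most `B / 2` by Popoviciu's inequality. -/
lemma abs_le_and_integral_abs_le {ξ : Ω → ℝ} (hξ : AEMeasurable ξ P) {a : ℝ} {B : ℝ≥0}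
    (hB : ∀ᵐ ω ∂P, ξ ω ∈ Set.Icc a (a + B)) (h0 : ∫ ω, ξ ω ∂P = 0) :
    (∀ᵐ ω ∂P, |ξ ω| ≤ B) ∧ ∫ ω, |ξ ω| ∂P ≤ B / 2 := by
  have ti : MemLp ξ ⊤ P := memLp_top_of_bound hξ.aestronglyMeasurable (|a| + |a + B|) (by
    filter_upwards [hB] with ω hω
    rw [Real.norm_eq_abs, abs_le]
    constructor
    · linarith [hω.1, neg_abs_le a, abs_nonneg (a + B)]
    · linarith [hω.2, le_abs_self (a + B), abs_nonneg a])
  have i1 := ti.integrable le_top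
  have ha : a ≤ 0 := by
    have := integral_mono_ae (integrable_const a) i1 (hB.mono fun ω h => h.1)
    simpa [h0] using this
  have hb : 0 ≤ a + B := by
    have := integral_mono_ae i1 (integrable_const (a + B)) (hB.mono fun ω h => h.2)
    simpa [h0] using this
  refine ⟨hB.mono fun ω h => abs_le.2 ⟨by linarith [h.1], by linarith [h.2]⟩, ?_⟩
  have h2 : Var[ξ; P] ≤ ((a + B - a) / 2) ^ 2 := variance_le_sq_of_bounded hB hξ
  have h3 := variance_nonneg (fun ω => |ξ ω|) P
  rw [variance_eq_sub (by exact (ti.abs.mono_exponent le_top))] at h3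
  rw [variance_of_integral_eq_zero hξ h0] at h2
  simp only [Pi.pow_apply, sq_abs, add_sub_cancel_left] at h3 h2
  exact abs_le_of_sq_le_sq' (by linarith) (by positivity) |>.2

/-- **Stein's method for sums of negatively dependent variables.** If the covariances of Lipschitz
functions of a summand and of the sum of the others are controlled by the covariance itself, the
distance of the standardized sum to the normal law is controlled by the size of the summands and by
the total off-diagonal covariance. -/
theorem d1_sum_le {ι : Type*} (s : Finset ι) {ξ : ι → Ω → ℝ} {W : Ω → ℝ}
    (hW : ∀ ω, W ω = ∑ i ∈ s, ξ i ω) (hξ : ∀ i, AEMeasurable (ξ i) P) {B : ℝ≥0}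
    (hB : ∀ i, ∃ a : ℝ, ∀ᵐ ω ∂P, ξ i ω ∈ Set.Icc a (a + B)) (h0 : ∀ i, ∫ ω, ξ i ω ∂P = 0)
    (hvar : ∫ ω, W ω ^ 2 ∂P = 1)
    (hcov : ∀ i ∈ s, ∀ (φ ψ : ℝ → ℝ) (L L' : ℝ≥0), LipschitzWith L φ → LipschitzWith L' ψ →
      |covariance (fun ω => φ (ξ i ω)) (fun ω => ψ (W ω - ξ i ω)) P| ≤
        -(L * L' * covariance (ξ i) (fun ω => W ω - ξ i ω) P)) :
    d1 (P.map W) (gaussianReal 0 1) ≤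
      ENNReal.ofReal (5 * B - 10.4 * ∑ i ∈ s, covariance (ξ i) (fun ω => W ω - ξ i ω) P) := by
  choose a ha using hB
  have hb := fun i => abs_le_and_integral_abs_le (hξ i) (ha i) (h0 i)
  have tξ : ∀ i, MemLp (ξ i) ⊤ P := fun i =>
    memLp_top_of_bound (hξ i).aestronglyMeasurable B (hb i).1
  have tW : MemLp W ⊤ P := by
    have : W = ∑ i ∈ s, ξ i := by funext ω; simp [hW]
    rw [this]; exact memLp_finsetSum' s fun i _ => tξ i
  have mW : AEMeasurable W P := tW.aestronglyMeasurable.aemeasurable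
  have iW : Integrable W P := tW.integrable le_top
  have iW2 : Integrable (fun ω => W ω ^ 2) P := (tW.mono_exponent le_top).integrable_sq
  have iξW : ∀ i, Integrable (fun ω => ξ i ω * W ω) P := fun i =>
    (tW.mul (tξ i)).integrable le_top
  have mV : ∀ i, AEMeasurable (fun ω => W ω - ξ i ω) P := fun i => mW.sub (hξ i)
  set c : ι → ℝ := fun i => -covariance (ξ i) (fun ω => W ω - ξ i ω) P with hc
  have c0 : ∀ i ∈ s, 0 ≤ c i := fun i hi => by
    have := hcov i hi id id 1 1 LipschitzWith.id LipschitzWith.id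
    simp only [id, NNReal.coe_one, one_mul] at this
    exact (abs_nonneg _).trans this
  have hV0 : 0 ≤ ∑ i ∈ s, c i := Finset.sum_nonneg c0
  -- The variances of the summands add up to one plus the total negative covariance.
  have hσ : ∑ i ∈ s, ∫ ω, ξ i ω ^ 2 ∂P = 1 + ∑ i ∈ s, c i := by
    have e : ∀ i, c i = ∫ ω, ξ i ω ^ 2 ∂P - ∫ ω, ξ i ω * W ω ∂P := by
      intro i
      have t2 : MemLp (fun ω => W ω - ξ i ω) ⊤ P := tW.sub (tξ i)
      simp only [hc]
      rw [covariance_eq_sub ((tξ i).mono_exponent le_top) (t2.mono_exponent le_top), h0 i,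
        zero_mul, sub_zero,
        ← integral_sub (((tξ i).mono_exponent le_top).integrable_sq) (iξW i), ← integral_neg]
      refine integral_congr_ae (Filter.Eventually.of_forall fun ω => ?_)
      simp only [Pi.mul_apply]; ring
    have e2 : ∑ i ∈ s, ∫ ω, ξ i ω * W ω ∂P = 1 := by
      rw [← integral_finsetSum s fun i _ => iξW i, ← hvar]
      refine integral_congr_ae (Filter.Eventually.of_forall fun ω => ?_)
      simp only [pow_two]
      rw [← Finset.sum_mul, ← hW]
    simp only [e, Finset.sum_sub_distrib, e2]; ring
  have hE : ∫ ω, |W ω| ∂P ≤ 1 := by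
    have := integral_mono iW.abs ((iW2.add (integrable_const 1)).div_const 2)
      fun ω => show |W ω| ≤ (W ω ^ 2 + 1) / 2 by nlinarith [sq_nonneg (|W ω| - 1), sq_abs (W ω)]
    refine this.trans ?_
    rw [integral_div]
    simp only [Pi.add_apply]
    rw [integral_add iW2 (integrable_const 1), hvar]
    simp
  have : IsProbabilityMeasure (P.map W) := Measure.isProbabilityMeasure_map mW
  have iid : Integrable id (P.map W) :=
    (integrable_map_measure aestronglyMeasurable_id mW).2 (by simpa using iW)
  refine d1_le_of_forall_C1 _ _ iid integrable_id_gaussianReal fun g g' hg _ hg' => ?_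
  have hgl := lipschitzWith_one_of_deriv hg hg'
  rw [integral_map mW hgl.continuous.aestronglyMeasurable]
  have igW : Integrable (fun ω => g (W ω)) P :=
    (integrable_map_measure hgl.continuous.aestronglyMeasurable mW).1
      (integrable_of_lipschitzWith_one iid hgl)
  set N := ∫ x, g x ∂(gaussianReal 0 1) with hN
  have eN : ∫ ω, g (W ω) ∂P - N = ∫ ω, (g (W ω) - N) ∂P := by
    rw [integral_sub igW (integrable_const _)]; simp
  have ec : 5 * (B : ℝ) - 10.4 * ∑ i ∈ s, covariance (ξ i) (fun ω => W ω - ξ i ω) P =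
      5 * B + 10.4 * ∑ i ∈ s, c i := by simp only [hc, Finset.sum_neg_distrib]; ring
  rw [eN, ec]
  -- For `B ≥ 2 / 5` the bound is weaker than the trivial one, `E|W| + E|Z| ≤ 2`.
  rcases le_total (2 / 5) (B : ℝ) with hB' | hB'
  · have := integral_mono (igW.sub (integrable_const N)) (iW.abs.add (integrable_const 1))
      fun ω => (le_abs_self _).trans (abs_sub_integral_gaussianReal_le hgl (W ω))
    simp only [Pi.add_apply, Pi.sub_apply] at this
    rw [integral_add iW.abs (integrable_const 1)] at this
    simp only [integral_const, probReal_univ, smul_eq_mul, mul_one] at this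
    linarith
  obtain ⟨f, p, hf, hp, fb, pb, heq⟩ := exists_stein_solution hg hg'
  have fm : Measurable f :=
    (continuous_iff_continuousAt.2 fun x => (hf x).continuousAt).measurable
  have tfW : MemLp (fun ω => f (W ω)) ⊤ P := memLp_top_of_bound
    (fm.comp_aemeasurable mW).aestronglyMeasurable 1 (Filter.Eventually.of_forall fun ω => fb _)
  have tpW : MemLp (fun ω => p (W ω)) ⊤ P := memLp_top_of_bound
    (hp.continuous.measurable.comp_aemeasurable mW).aestronglyMeasurable 2.8
    (Filter.Eventually.of_forall fun ω => pb _)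
  have iξf : ∀ i, Integrable (fun ω => ξ i ω * f (W ω)) P := fun i =>
    (tfW.mul (tξ i)).integrable le_top
  have iWf : Integrable (fun ω => W ω * f (W ω)) P := (tfW.mul tW).integrable le_top
  have step : ∀ i ∈ s, |∫ ω, ξ i ω * f (W ω) ∂P - (∫ ω, ξ i ω ^ 2 ∂P) * ∫ ω, p (W ω) ∂P| ≤
      (2.8 + 8 * B) * c i + 4 * B * ∫ ω, ξ i ω ^ 2 ∂P := by
    intro i hi
    obtain ⟨F, hF⟩ : ∃ F : ℝ≥0, (F : ℝ) = 2.8 := ⟨⟨2.8, by norm_num⟩, rfl⟩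
    have h := abs_integral_mul_sub_le (hξ i) (mV i) (hb i).1 (h0 i) (hb i).2 (hcov i hi)
      hf hp (F := F) fb (fun w => (pb w).trans hF.ge)
    simp only [sub_add_cancel, NNReal.coe_ofNat, hF] at h
    refine h.trans (le_of_eq ?_)
    simp only [hc]; ring
  have eWf : ∫ ω, W ω * f (W ω) ∂P = ∑ i ∈ s, ∫ ω, ξ i ω * f (W ω) ∂P := by
    rw [← integral_finsetSum s fun i _ => iξf i]
    refine integral_congr_ae (Filter.Eventually.of_forall fun ω => ?_)
    simp only
    rw [← Finset.sum_mul, ← hW]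
  have tot : |∫ ω, W ω * f (W ω) ∂P - (1 + ∑ i ∈ s, c i) * ∫ ω, p (W ω) ∂P| ≤
      (2.8 + 8 * B) * (∑ i ∈ s, c i) + 4 * B * (1 + ∑ i ∈ s, c i) := by
    rw [eWf, ← hσ, Finset.sum_mul, ← Finset.sum_sub_distrib, Finset.mul_sum, Finset.mul_sum,
      ← Finset.sum_add_distrib]
    exact (Finset.abs_sum_le_sum_abs _ _).trans (Finset.sum_le_sum step)
  have pE : |∫ ω, p (W ω) ∂P| ≤ 2.8 := by
    simpa using norm_integral_le_of_norm_le_const (μ := P) (f := fun ω => p (W ω))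
      (Filter.Eventually.of_forall fun ω => pb _)
  have eS : ∫ ω, (g (W ω) - N) ∂P = ∫ ω, p (W ω) ∂P - ∫ ω, W ω * f (W ω) ∂P := by
    rw [← integral_sub (tpW.integrable le_top) iWf]
    exact integral_congr_ae (Filter.Eventually.of_forall fun ω => (heq (W ω)).symm)
  rw [eS]
  set S := ∑ i ∈ s, c i
  have t1 := (abs_le.1 tot).1
  have t2 : -(S * ∫ ω, p (W ω) ∂P) ≤ 2.8 * S := by
    nlinarith [(abs_le.1 pE).1]
  have t3 : (B : ℝ) * S ≤ 2 / 5 * S := mul_le_mul_of_nonneg_right hB' hV0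
  have t4 : (0 : ℝ) ≤ B := B.2
  linarith

end Sums

/-! ### Covariance inequalities under negative association -/

lemma memLp_two_comp_lipschitz {Ω : Type*} [MeasurableSpace Ω] {P : Measure Ω}
    [IsProbabilityMeasure P] {U : Ω → ℝ} (hU : MemLp U 2 P) {φ : ℝ → ℝ} {L : ℝ≥0}
    (hφ : LipschitzWith L φ) : MemLp (fun ω => φ (U ω)) 2 P := by
  have h := ((hU.norm.const_mul (L : ℝ)).add (memLp_const |φ 0|))
  refine h.mono (hφ.continuous.comp_aestronglyMeasurable hU.1)
    (Filter.Eventually.of_forall fun ω => ?_)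
  have := hφ.dist_le_mul (U ω) 0
  simp only [Real.dist_eq, sub_zero] at this
  have h2 := abs_sub_abs_le_abs_sub (φ (U ω)) (φ 0)
  refine le_trans ?_ (le_abs_self _)
  simp only [Real.norm_eq_abs, Pi.add_apply]
  linarith

lemma monotone_mul_add_lipschitz {φ : ℝ → ℝ} {L : ℝ≥0} (hφ : LipschitzWith L φ) {ε : ℝ}
    (hε : |ε| = 1) : Monotone fun x => L * x + ε * φ x := by
  intro x y hxy
  have h := hφ.dist_le_mul x y
  simp only [Real.dist_eq] at h
  rw [abs_of_nonpos (a := x - y) (by linarith)] at h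
  have h2 := (le_abs_self (ε * (φ x - φ y)))
  rw [abs_mul, hε, one_mul] at h2
  simp only
  linarith

lemma covariance_linear_comb {Ω : Type*} [MeasurableSpace Ω] {P : Measure Ω} [IsFiniteMeasure P]
    {U U' V V' : Ω → ℝ} (hU : MemLp U 2 P) (hU' : MemLp U' 2 P) (hV : MemLp V 2 P)
    (hV' : MemLp V' 2 P) (a b c e : ℝ) :
    covariance (fun ω => a * U ω + b * U' ω) (fun ω => c * V ω + e * V' ω) P =
      a * c * covariance U V P + a * e * covariance U V' P + b * c * covariance U' V P +
        b * e * covariance U' V' P := by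
  have h2 := (hV.const_mul c).add (hV'.const_mul e)
  refine (covariance_add_left (hU.const_mul a) (hU'.const_mul b) h2).trans ?_
  rw [covariance_add_right (hU.const_mul a) (hV.const_mul c) (hV'.const_mul e),
    covariance_add_right (hU'.const_mul b) (hV.const_mul c) (hV'.const_mul e)]
  simp only [covariance_const_mul_left, covariance_const_mul_right]
  ring

/-- For a negatively associated family, the covariance of Lipschitz functions of sums over disjoint
index sets is controlled by the covariance of the sums: `L x ± φ x` is nondecreasing when `φ` is
`L`-Lipschitz. -/
lemma NegativelyAssociated.abs_covariance_lipschitz_le {Ω ι : Type*} [MeasurableSpace Ω]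
    {P : Measure Ω} [IsProbabilityMeasure P] {X : ι → Ω → ℝ} (hX : NegativelyAssociated P X)
    (hX2 : ∀ j, MemLp (X j) 2 P) {A B : Finset ι} (hAB : Disjoint A B) {φ ψ : ℝ → ℝ} {L L' : ℝ≥0}
    (hφ : LipschitzWith L φ) (hψ : LipschitzWith L' ψ) :
    |covariance (fun ω => φ (∑ i ∈ A, X i ω)) (fun ω => ψ (∑ j ∈ B, X j ω)) P| ≤
      -(L * L' * covariance (fun ω => ∑ i ∈ A, X i ω) (fun ω => ∑ j ∈ B, X j ω) P) := by
  have hS : ∀ A : Finset ι, MemLp (fun ω => ∑ i ∈ A, X i ω) 2 P := fun A =>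
    memLp_finsetSum A fun i _ => hX2 i
  set U : Ω → ℝ := fun ω => ∑ i ∈ A, X i ω with hU
  set V : Ω → ℝ := fun ω => ∑ j ∈ B, X j ω with hV
  have hφU := memLp_two_comp_lipschitz (hS A) hφ
  have hψV := memLp_two_comp_lipschitz (hS B) hψ
  have key : ∀ ε δ : ℝ, |ε| = 1 → |δ| = 1 →
      L * L' * covariance U V P + L * δ * covariance U (fun ω => ψ (V ω)) P +
        ε * L' * covariance (fun ω => φ (U ω)) V P +
        ε * δ * covariance (fun ω => φ (U ω)) (fun ω => ψ (V ω)) P ≤ 0 := by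
    intro ε δ hε hδ
    have mono : ∀ (A : Finset ι) {φ : ℝ → ℝ}, Monotone φ →
        Monotone fun x : A → ℝ => φ (∑ i, x i) := fun A φ h x y hxy =>
      h (Finset.sum_le_sum fun i _ => hxy i)
    have sub : ∀ (A : Finset ι) ω, ∑ i : A, X i ω = ∑ i ∈ A, X i ω := fun A ω =>
      Finset.sum_coe_sort A fun i => X i ω
    have meas : ∀ (A : Finset ι) {φ : ℝ → ℝ}, Measurable φ →
        Measurable fun x : A → ℝ => φ (∑ i, x i) := fun A φ h =>
      h.comp (Finset.measurable_fun_sum _ fun i _ => measurable_pi_apply i)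
    have m1 := hφ.continuous.measurable
    have m2 := hψ.continuous.measurable
    have l1 : MemLp (fun ω => L * U ω + ε * φ (U ω)) 2 P :=
      ((hS A).const_mul _).add (hφU.const_mul _)
    have l2 : MemLp (fun ω => L' * V ω + δ * ψ (V ω)) 2 P :=
      ((hS B).const_mul _).add (hψV.const_mul _)
    have h := hX A B hAB (fun x => L * (∑ i, x i) + ε * φ (∑ i, x i))
      (fun x => L' * (∑ i, x i) + δ * ψ (∑ i, x i))
      (mono A (monotone_mul_add_lipschitz hφ hε)) (mono B (monotone_mul_add_lipschitz hψ hδ))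
      (meas A (φ := fun x => L * x + ε * φ x) (by fun_prop))
      (meas B (φ := fun x => L' * x + δ * ψ x) (by fun_prop))
      (by simpa only [sub] using l1) (by simpa only [sub] using l2)
    simp only [sub] at h
    rw [covariance_linear_comb (hS A) hφU (hS B) hψV] at h
    linarith
  rw [abs_le]
  have k1 := key 1 1 (by simp) (by simp)
  have k2 := key (-1) (-1) (by simp) (by simp)
  have k3 := key 1 (-1) (by simp) (by simp)
  have k4 := key (-1) 1 (by simp) (by simp)
  constructor <;> linarith

/-! ### Exponentially weighted sums over the lattice -/

section Geometric

variable {r : ℝ}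

lemma sum_range_pow_sub_le (h0 : 0 ≤ r) (h1 : r < 1) (m : ℕ) :
    ∑ a ∈ Finset.range m, r ^ (m - a) ≤ r / (1 - r) := by
  have h1' : 0 < 1 - r := sub_pos.2 h1
  induction m with
  | zero => simp; positivity
  | succ m ih =>
    have e : ∑ a ∈ Finset.range m, r ^ (m + 1 - a) = r * ∑ a ∈ Finset.range m, r ^ (m - a) := by
      rw [Finset.mul_sum]
      refine Finset.sum_congr rfl fun a ha => ?_
      rw [← pow_succ', Nat.sub_add_comm (Finset.mem_range.1 ha).le]
    rw [Finset.sum_range_succ, e, Nat.add_sub_cancel_left, pow_one]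
    calc _ ≤ r * (r / (1 - r)) + r := by gcongr
      _ = _ := by field_simp; ring

lemma sum_Ico_pow_sub_le (h0 : 0 ≤ r) (h1 : r < 1) (m n : ℕ) :
    ∑ b ∈ Finset.Ico m n, r ^ (b - m) ≤ 1 / (1 - r) := by
  have h1' : 0 < 1 - r := sub_pos.2 h1
  rw [Finset.sum_Ico_eq_sum_range]
  simp only [Nat.add_sub_cancel_left]
  rw [le_div_iff₀ h1', geom_sum_mul_neg]
  linarith [pow_nonneg h0 (n - m)]

/-- The exponential weight `r ^ |a - b|`. -/
def decay (r : ℝ) (a b : ℕ) : ℝ := r ^ ((a : ℤ) - b).natAbs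

lemma decay_nonneg (h0 : 0 ≤ r) (a b : ℕ) : 0 ≤ decay r a b := pow_nonneg h0 _

lemma sum_sum_decay_le (h0 : 0 ≤ r) (h1 : r < 1) (n : ℕ) :
    ∑ a ∈ Finset.range n, ∑ b ∈ Finset.range n, decay r a b ≤ n * (1 / (1 - r) ^ 2) := by
  have h1' : 0 < 1 - r := sub_pos.2 h1
  rw [← nsmul_eq_mul]
  nth_rw 3 [← Finset.card_range n]
  refine Finset.sum_le_card_nsmul _ _ _ fun a ha => ?_
  have hs : ∑ b ∈ Finset.range n, decay r a b =
      ∑ b ∈ Finset.range a, decay r a b + ∑ b ∈ Finset.Ico a n, decay r a b :=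
    (Finset.sum_range_add_sum_Ico _ (Finset.mem_range.1 ha).le).symm
  have s1 : ∑ b ∈ Finset.range a, decay r a b ≤ r / (1 - r) := by
    refine (Finset.sum_congr rfl fun b hb => ?_).trans_le (sum_range_pow_sub_le h0 h1 a)
    have := Finset.mem_range.1 hb
    rw [decay]; congr 1; omega
  have s2 : ∑ b ∈ Finset.Ico a n, decay r a b ≤ 1 / (1 - r) := by
    refine (Finset.sum_congr rfl fun b hb => ?_).trans_le (sum_Ico_pow_sub_le h0 h1 a n)
    have := Finset.mem_Ico.1 hb
    rw [decay]; congr 1; omega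
  rw [hs]
  refine (add_le_add s1 s2).trans ?_
  rw [← add_div, div_le_div_iff₀ h1' (by positivity)]
  nlinarith [mul_nonneg h1'.le (sq_nonneg r)]

/-- The total weight of the pairs separated by the boundary point `m`. -/
lemma sum_sum_decay_across_le (h0 : 0 ≤ r) (h1 : r < 1) (n m : ℕ) :
    ∑ a ∈ Finset.range n, ∑ b ∈ Finset.range n, (if a < m ∧ m ≤ b then decay r a b else 0) ≤
      r / (1 - r) ^ 2 := by
  have h1' : 0 < 1 - r := sub_pos.2 h1
  have e : ∀ a b, (if a < m ∧ m ≤ b then decay r a b else 0) =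
      (if a < m then r ^ (m - a) else 0) * (if m ≤ b then r ^ (b - m) else 0) := by
    intro a b
    by_cases ha : a < m <;> by_cases hb : m ≤ b <;> simp [ha, hb]
    rw [decay, ← pow_add]; congr 1; omega
  simp only [e, ← Finset.mul_sum, ← Finset.sum_mul]
  rw [show r / (1 - r) ^ 2 = r / (1 - r) * (1 / (1 - r)) by field_simp]
  refine mul_le_mul ?_ ?_ (Finset.sum_nonneg fun b _ => by split_ifs <;> positivity) (by positivity)
  · rw [← Finset.sum_filter]
    refine (Finset.sum_le_sum_of_subset_of_nonneg (fun a ha => ?_) fun a _ _ => by positivity).trans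
      (sum_range_pow_sub_le h0 h1 m)
    simpa using (Finset.mem_filter.1 ha).2
  · rw [← Finset.sum_filter]
    refine (Finset.sum_le_sum_of_subset_of_nonneg (fun b hb => ?_) fun b _ _ => by positivity).trans
      (sum_Ico_pow_sub_le h0 h1 m n)
    have := Finset.mem_filter.1 hb
    exact Finset.mem_Ico.2 ⟨this.2, Finset.mem_range.1 this.1⟩

/-- The total weight of the pairs lying in different cells of length `L`. Each such pair is separated
by one of the at most `n / L` multiples of `L` up to `n`. -/
lemma sum_sum_decay_off_le (h0 : 0 ≤ r) (h1 : r < 1) (n : ℕ) {L : ℕ} (hL : 0 < L) :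
    ∑ a ∈ Finset.range n, ∑ b ∈ Finset.range n, (if a / L = b / L then 0 else decay r a b) ≤
      n / L * (2 * (r / (1 - r) ^ 2)) := by
  have h1' : 0 < 1 - r := sub_pos.2 h1
  have pt : ∀ a ∈ Finset.range n, ∀ b ∈ Finset.range n,
      (if a / L = b / L then 0 else decay r a b) ≤ ∑ c ∈ Finset.Icc 1 (n / L),
        ((if a < c * L ∧ c * L ≤ b then decay r a b else 0) +
          (if b < c * L ∧ c * L ≤ a then decay r b a else 0)) := by
    intro a ha b hb
    have sym : decay r b a = decay r a b := by rw [decay, decay]; congr 1; omega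
    have nn : ∀ c ∈ Finset.Icc 1 (n / L), 0 ≤
        ((if a < c * L ∧ c * L ≤ b then decay r a b else 0) +
          (if b < c * L ∧ c * L ≤ a then decay r b a else 0)) := fun c _ => by
      have := decay_nonneg h0 a b
      have := decay_nonneg h0 b a
      positivity
    have hn : ∀ x ∈ Finset.range n, x / L ≤ n / L := fun x hx =>
      Nat.div_le_div_right (Finset.mem_range.1 hx).le
    rcases lt_trichotomy (a / L) (b / L) with h | h | h
    · refine le_trans ?_ (Finset.single_le_sum nn (a := b / L)
        (Finset.mem_Icc.2 ⟨(Nat.zero_le _).trans_lt h, hn b hb⟩))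
      have c1 : a < b / L * L := (Nat.div_lt_iff_lt_mul hL).1 h
      have c2 : b / L * L ≤ b := Nat.div_mul_le_self b L
      rw [if_neg h.ne, if_pos ⟨c1, c2⟩, if_neg (by omega), add_zero]
    · rw [if_pos h]; exact Finset.sum_nonneg nn
    · refine le_trans ?_ (Finset.single_le_sum nn (a := a / L)
        (Finset.mem_Icc.2 ⟨(Nat.zero_le _).trans_lt h, hn a ha⟩))
      have c1 : b < a / L * L := (Nat.div_lt_iff_lt_mul hL).1 h
      have c2 : a / L * L ≤ a := Nat.div_mul_le_self a L
      rw [if_neg h.ne', if_neg (by omega), if_pos ⟨c1, c2⟩, zero_add, sym]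
  refine (Finset.sum_le_sum fun a ha => Finset.sum_le_sum (pt a ha)).trans ?_
  have swap : ∀ F : ℕ → ℕ → ℕ → ℝ, ∑ a ∈ Finset.range n, ∑ b ∈ Finset.range n,
      ∑ c ∈ Finset.Icc 1 (n / L), F a b c =
      ∑ c ∈ Finset.Icc 1 (n / L), ∑ a ∈ Finset.range n, ∑ b ∈ Finset.range n, F a b c := by
    intro F
    rw [Finset.sum_comm]
    simp only [Finset.sum_comm (s := Finset.range n) (t := Finset.Icc 1 (n / L))]
    exact Finset.sum_congr rfl fun _ _ => Finset.sum_comm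
  rw [swap]
  have each : ∀ c ∈ Finset.Icc 1 (n / L), ∑ a ∈ Finset.range n, ∑ b ∈ Finset.range n,
      ((if a < c * L ∧ c * L ≤ b then decay r a b else 0) +
          (if b < c * L ∧ c * L ≤ a then decay r b a else 0)) ≤ 2 * (r / (1 - r) ^ 2) := by
    intro c _
    simp only [Finset.sum_add_distrib]
    rw [Finset.sum_comm (f := fun a b => if b < c * L ∧ c * L ≤ a then decay r b a else 0)]
    have := sum_sum_decay_across_le h0 h1 n (c * L)
    linarith
  refine (Finset.sum_le_card_nsmul _ _ _ each).trans ?_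
  rw [nsmul_eq_mul, Nat.card_Icc, Nat.add_sub_cancel]
  gcongr
  exact Nat.cast_div_le

end Geometric

lemma pow_sub_pow_le_mul {x y x' y' c : ℝ} (hy : 0 ≤ y) (hyx : y ≤ x) (hyy : y ≤ y') (hxx : x ≤ x')
    (h : x - y ≤ c * (x' - y')) (d : ℕ) :
    x ^ d - y ^ d ≤ c * (x' ^ d - y' ^ d) := by
  have hx : 0 ≤ x := hy.trans hyx
  have hx' : 0 ≤ x' := hx.trans hxx
  rw [← (Commute.all x y).geom_sum₂_mul d, ← (Commute.all x' y').geom_sum₂_mul d]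
  have hs : ∑ i ∈ Finset.range d, x ^ i * y ^ (d - 1 - i) ≤
      ∑ i ∈ Finset.range d, x' ^ i * y' ^ (d - 1 - i) := by gcongr
  have h0 : 0 ≤ ∑ i ∈ Finset.range d, x ^ i * y ^ (d - 1 - i) :=
    Finset.sum_nonneg fun i _ => by positivity
  calc _ ≤ (∑ i ∈ Finset.range d, x' ^ i * y' ^ (d - 1 - i)) * (c * (x' - y')) :=
        mul_le_mul hs h (sub_nonneg.2 hyx) (h0.trans hs)
    _ = _ := by ring

lemma sum_piFinset_sum_piFinset_prod {d : ℕ} (t : Fin d → Finset ℤ) (F : ℤ → ℤ → Fin d → ℝ) :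
    ∑ i ∈ Fintype.piFinset t, ∑ j ∈ Fintype.piFinset t, ∏ s, F (i s) (j s) s =
      ∏ s, ∑ a ∈ t s, ∑ b ∈ t s, F a b s := by
  rw [Finset.prod_univ_sum]
  exact Finset.sum_congr rfl fun i _ => (Finset.prod_univ_sum t fun s b => F (i s) b s).symm

lemma sum_Ico_int_eq_sum_range {M : Type*} [AddCommMonoid M] (k : ℤ) (n : ℕ) (F : ℤ → M) :
    ∑ a ∈ Finset.Ico k (k + n), F a = ∑ a ∈ Finset.range n, F (k + a) := by
  symm
  refine Finset.sum_bij (fun a _ => k + (a : ℤ)) (fun a ha => ?_) (fun a _ b _ h => by omega)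
    (fun b hb => ⟨(b - k).toNat, ?_, ?_⟩) fun _ _ => rfl
  · simp at ha ⊢; omega
  · simp at hb ⊢; omega
  · simp at hb ⊢; omega

lemma gammaC_eq (l : ℝ) (d : ℕ) :
    gammaC l d = 2 ^ d * ((2 * muC l + nuC l) ^ d - nuC l ^ d) := by
  rw [gammaC, mul_sub, ← mul_pow, ← mul_pow]; ring_nf

lemma muC_eq (l : ℝ) : muC l = Real.exp (-l) / (1 - Real.exp (-l)) ^ 2 := by
  have h := Real.exp_pos l
  rw [muC, Real.exp_neg]
  rw [show 1 - (Real.exp l)⁻¹ = (Real.exp l - 1) / Real.exp l by field_simp, div_pow]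
  field_simp

lemma nuC_eq (l : ℝ) : nuC l = 1 / (1 - Real.exp (-l)) ^ 2 := by
  have h := Real.exp_pos l
  rw [nuC, Real.exp_neg]
  rw [show 1 - (Real.exp l)⁻¹ = (Real.exp l - 1) / Real.exp l by field_simp, div_pow,
    two_mul, Real.exp_add]
  field_simp

lemma muC_pos {l : ℝ} (hl : 0 < l) : 0 < muC l := by
  have : 0 < Real.exp l - 1 := by linarith [Real.add_one_lt_exp hl.ne']
  rw [muC]; positivity

lemma nuC_pos {l : ℝ} (hl : 0 < l) : 0 < nuC l := by
  have : 0 < Real.exp l - 1 := by linarith [Real.add_one_lt_exp hl.ne']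
  rw [nuC]; positivity

/-- The index of the cell of side `L`, in the tiling that starts at `k`, to which a lattice point
belongs. -/
def cell {d : ℕ} (k : Fin d → ℤ) (L : ℕ) (j : Fin d → ℤ) : Fin d → ℤ := fun s => (j s - k s) / L

/-- The total exponential weight of the pairs of points of a block lying in different cells. It is
the difference of the weight of all pairs and of the pairs in a common cell, and both are `d`-th
powers of one-dimensional sums. -/
lemma sum_sum_exp_off_cell_le {d : ℕ} (hd : 1 ≤ d) {l : ℝ} (hl : 0 < l) (k : Fin d → ℤ) (n : ℕ)
    {L : ℕ} (hL : 0 < L) :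
    ∑ i ∈ block k n, ∑ j ∈ block k n,
      (if cell k L i = cell k L j then 0 else Real.exp (-l * norm1 (i - j))) ≤
      (n : ℝ) ^ d / L * (gammaC l d / 2) := by
  set r := Real.exp (-l) with hr
  have r0 : 0 ≤ r := (Real.exp_pos _).le
  have r1 : r < 1 := by rw [hr, Real.exp_lt_one_iff]; linarith
  set w : ℤ → ℤ → ℝ := fun a b => Real.exp (-l * |((a - b : ℤ) : ℝ)|) with hw
  have hwd : ∀ (c : ℤ) (a b : ℕ), w (c + a) (c + b) = decay r a b := by
    intro c a b
    simp only [hw, decay, hr]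
    rw [← Real.exp_nat_mul, Nat.cast_natAbs]
    push_cast
    ring_nf
  have hexp : ∀ i j : Fin d → ℤ, Real.exp (-l * norm1 (i - j)) = ∏ s, w (i s) (j s) := by
    intro i j
    simp only [norm1, hw, Finset.mul_sum, Real.exp_sum, Pi.sub_apply]
  have hcell : ∀ (c : ℤ) (a : ℕ), (c + a - c) / (L : ℤ) = ((a / L : ℕ) : ℤ) := fun c a => by
    simp
  have split : ∀ i j : Fin d → ℤ,
      (if cell k L i = cell k L j then 0 else Real.exp (-l * norm1 (i - j))) =
      ∏ s, w (i s) (j s) -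
        ∏ s, if (i s - k s) / (L : ℤ) = (j s - k s) / L then w (i s) (j s) else 0 := by
    intro i j
    rw [hexp]
    split_ifs with h
    · have : ∀ s, (i s - k s) / (L : ℤ) = (j s - k s) / L := fun s => congrFun h s
      simp [this]
    · obtain ⟨s, hs⟩ : ∃ s, (i s - k s) / (L : ℤ) ≠ (j s - k s) / L := by
        by_contra! hc; exact h (funext hc)
      rw [Finset.prod_eq_zero (f := fun s => if (i s - k s) / (L : ℤ) = (j s - k s) / L then
        w (i s) (j s) else 0) (Finset.mem_univ s) (if_neg hs), sub_zero]
  simp only [split, Finset.sum_sub_distrib, block]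
  rw [sum_piFinset_sum_piFinset_prod _ fun a b _ => w a b,
    sum_piFinset_sum_piFinset_prod _ fun a b s =>
      if (a - k s) / (L : ℤ) = (b - k s) / L then w a b else 0]
  simp only [sum_Ico_int_eq_sum_range, hwd, hcell, Nat.cast_inj, Finset.prod_const,
    Finset.card_univ, Fintype.card_fin]
  set T := ∑ a ∈ Finset.range n, ∑ b ∈ Finset.range n, decay r a b with hT
  set D := ∑ a ∈ Finset.range n, ∑ b ∈ Finset.range n,
    (if a / L = b / L then decay r a b else 0) with hD
  have hTD : T - D = ∑ a ∈ Finset.range n, ∑ b ∈ Finset.range n,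
      (if a / L = b / L then 0 else decay r a b) := by
    simp only [hT, hD, ← Finset.sum_sub_distrib]
    refine Finset.sum_congr rfl fun a _ => Finset.sum_congr rfl fun b _ => ?_
    split_ifs <;> simp
  have hD0 : 0 ≤ D := Finset.sum_nonneg fun a _ => Finset.sum_nonneg fun b _ => by
    have := decay_nonneg r0 a b
    positivity
  have hTD0 : 0 ≤ T - D := by
    rw [hTD]
    exact Finset.sum_nonneg fun a _ => Finset.sum_nonneg fun b _ => by
      have := decay_nonneg r0 a b
      positivity
  have hTn : T ≤ n * nuC l := by rw [nuC_eq]; exact sum_sum_decay_le r0 r1 n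
  have hO : T - D ≤ n / L * (2 * muC l) := by
    rw [hTD, muC_eq]; exact sum_sum_decay_off_le r0 r1 n hL
  have mu0 := (muC_pos hl).le
  have nu0 := (nuC_pos hl).le
  have hL' : (0 : ℝ) < L := Nat.cast_pos.2 hL
  have main := pow_sub_pow_le_mul (x := T) (y := D) (x' := n * (2 * muC l + nuC l))
    (y' := n * nuC l) (c := 1 / L) hD0 (by linarith) (by linarith)
    (hTn.trans (by gcongr; linarith)) (hO.trans_eq (by field_simp; ring)) d
  refine main.trans ?_
  rw [gammaC_eq, mul_pow, mul_pow, ← mul_sub]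
  have hg : 0 ≤ (2 * muC l + nuC l) ^ d - nuC l ^ d :=
    sub_nonneg.2 (pow_le_pow_left₀ nu0 (by linarith) d)
  have h2 : (2 : ℝ) ≤ 2 ^ d := by
    calc (2 : ℝ) = 2 ^ 1 := by norm_num
      _ ≤ 2 ^ d := pow_le_pow_right₀ (by norm_num) hd
  calc _ = (n : ℝ) ^ d / L * (2 * ((2 * muC l + nuC l) ^ d - nuC l ^ d) / 2) := by ring
    _ ≤ _ := by gcongr

/-! ### Tiling of a block into cells -/

lemma sum_block_translate {M : Type*} [AddCommMonoid M] {d : ℕ} (k k' : Fin d → ℤ) (n : ℕ)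
    (F : (Fin d → ℤ) → M) : ∑ j ∈ block k n, F j = ∑ j ∈ block k' n, F (j + (k - k')) := by
  symm
  refine Finset.sum_equiv (Equiv.addRight (k - k')) (fun j => ?_) fun _ _ => rfl
  simp only [block, Fintype.mem_piFinset, Finset.mem_Ico, Equiv.coe_addRight, Pi.add_apply,
    Pi.sub_apply]
  exact forall_congr' fun s => by constructor <;> intro h <;> constructor <;> linarith [h.1, h.2]

lemma card_filter_cell_le {d : ℕ} (k : Fin d → ℤ) (n : ℕ) {L : ℕ} (hL : 0 < L) (I : Fin d → ℤ) :
    ((block k n).filter fun j => cell k L j = I).card ≤ L ^ d := by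
  have hsub : ((block k n).filter fun j => cell k L j = I) ⊆
      block (fun s => k s + L * I s) L := by
    intro j hj
    have hj := (Finset.mem_filter.1 hj).2
    simp only [block, Fintype.mem_piFinset, Finset.mem_Ico]
    intro s
    have h : (j s - k s) / (L : ℤ) = I s := congrFun hj s
    have hL' : (0 : ℤ) < L := by exact_mod_cast hL
    have h1 := Int.mul_ediv_add_emod (j s - k s) L
    have h2 := Int.emod_nonneg (j s - k s) hL'.ne'
    have h3 := Int.emod_lt_of_pos (j s - k s) hL'
    rw [h] at h1
    constructor <;> linarith
  refine (Finset.card_le_card hsub).trans ?_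
  simp [block]

section Standardized

variable {Ω : Type*} [MeasurableSpace Ω] {P : Measure Ω} [IsProbabilityMeasure P] {d : ℕ}
  {X : (Fin d → ℤ) → Ω → ℝ}

lemma SecondOrderStationary.variance_blockSum (h : SecondOrderStationary P X) (k : Fin d → ℤ)
    {n : ℕ} (hn : 1 ≤ n) : Var[blockSum X k n; P] = (n : ℝ) ^ d * avgCov P X n := by
  have hS : AEMeasurable (blockSum X k n) P := Finset.aemeasurable_fun_sum _ fun j _ =>
    (h.1 j).aestronglyMeasurable.aemeasurable
  have e : covariance (blockSum X k n) (blockSum X k n) P =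
      ∑ i ∈ block k n, ∑ j ∈ block k n, covariance (X i) (X j) P :=
    covariance_fun_sum_fun_sum' (fun i _ => h.1 i) fun j _ => h.1 j
  rw [← covariance_self hS, e, avgCov, one_div,
    mul_inv_cancel_left₀ (by positivity), sum_block_translate k 1]
  refine Finset.sum_congr rfl fun i _ => ?_
  rw [sum_block_translate k 1]
  refine Finset.sum_congr rfl fun j _ => ?_
  rw [covariance_comm, h.2, add_sub_add_right_eq_sub]

lemma lipschitzWith_comp_affine {φ : ℝ → ℝ} {M : ℝ≥0} (hφ : LipschitzWith M φ) (τ : ℝ≥0) (m : ℝ) :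
    LipschitzWith (M * τ) fun x => φ ((x - m) * τ) := by
  refine hφ.comp (LipschitzWith.of_dist_le_mul fun x y => ?_)
  rw [Real.dist_eq, Real.dist_eq, ← sub_mul, abs_mul, sub_sub_sub_cancel_right, mul_comm,
    abs_of_nonneg (NNReal.coe_nonneg τ)]

/-- The bound obtained from a tiling of the block by cells of side `L`: Stein's method is applied to
the standardized sums over the cells. -/
theorem d1_stdBlockSum_le (hd : 1 ≤ d) (hNA : NegativelyAssociated P X)
    (hStat : SecondOrderStationary P X) {K : ℝ} (hK : 0 < K) (hbound : ∀ j, ∀ᵐ ω ∂P, |X j ω| ≤ K)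
    {l κ₀ : ℝ} (hl : 0 < l) (hκ₀ : 0 < κ₀)
    (hdecay : ∀ k : Fin d → ℤ, k ≠ 0 → -covFun P X k ≤ κ₀ * Real.exp (-l * norm1 k))
    (k : Fin d → ℤ) {n : ℕ} (hn : 1 ≤ n) (hA : 0 < avgCov P X n) {L : ℕ} (hL : 0 < L) :
    d1 (P.map (stdBlockSum P X k n)) (gaussianReal 0 1) ≤
      ENNReal.ofReal (10 * K / √((n : ℝ) ^ d * avgCov P X n) * L ^ d +
        5.2 * κ₀ * gammaC l d / avgCov P X n / L) := by
  classical
  set v : ℝ := (n : ℝ) ^ d * avgCov P X n with hv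
  have hn0 : (0 : ℝ) < n := by exact_mod_cast hn
  have hL0 : (0 : ℝ) < L := by exact_mod_cast hL
  have v0 : 0 < v := by positivity
  have sv0 : 0 < √v := Real.sqrt_pos.2 v0
  obtain ⟨τ, hτ⟩ : ∃ τ : ℝ≥0, (τ : ℝ) = (√v)⁻¹ := ⟨⟨(√v)⁻¹, by positivity⟩, rfl⟩
  have hτ2 : (τ : ℝ) * τ = v⁻¹ := by
    rw [hτ, ← mul_inv, Real.mul_self_sqrt v0.le]
  obtain ⟨B, hB⟩ : ∃ B : ℝ≥0, (B : ℝ) = 2 * K * L ^ d * τ :=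
    ⟨⟨2 * K * L ^ d * τ, by positivity⟩, rfl⟩
  have hX2 := hStat.1
  have hS2 : ∀ A : Finset (Fin d → ℤ), MemLp (fun ω => ∑ j ∈ A, X j ω) 2 P := fun A =>
    memLp_finsetSum A fun j _ => hX2 j
  have hSi : ∀ A : Finset (Fin d → ℤ), Integrable (fun ω => ∑ j ∈ A, X j ω) P := fun A =>
    (hS2 A).integrable one_le_two
  set b := block k n with hb
  set D : (Fin d → ℤ) → Finset (Fin d → ℤ) := fun I => b.filter fun j => cell k L j = I with hD
  set E : (Fin d → ℤ) → Finset (Fin d → ℤ) := fun I => b.filter fun j => ¬cell k L j = I with hE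
  set std : Finset (Fin d → ℤ) → Ω → ℝ := fun A ω =>
    (∑ j ∈ A, X j ω - ∫ ω', ∑ j ∈ A, X j ω' ∂P) * τ with hstd
  have hW : stdBlockSum P X k n = std b := by
    funext ω
    simp only [stdBlockSum, hstd, blockSum, hτ, div_eq_mul_inv, ← hv, ← hb]
  have hstdE : ∀ I ω, std b ω - std (D I) ω = std (E I) ω := by
    intro I ω
    have e : ∀ ω, ∑ j ∈ b, X j ω = ∑ j ∈ D I, X j ω + ∑ j ∈ E I, X j ω := fun ω =>
      (Finset.sum_filter_add_sum_filter_not b _ _).symm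
    simp only [hstd, e]
    rw [integral_add (hSi _) (hSi _)]
    ring
  have hdisj : ∀ I, Disjoint (D I) (E I) := fun I => Finset.disjoint_filter_filter_not _ _ _
  have hcovstd : ∀ A A', covariance (std A) (std A') P =
      v⁻¹ * covariance (fun ω => ∑ j ∈ A, X j ω) (fun ω => ∑ j ∈ A', X j ω) P := by
    intro A A'
    simp only [hstd]
    rw [covariance_mul_const_left, covariance_mul_const_right,
      covariance_sub_const_left (hSi A), covariance_sub_const_right (hSi A'), mul_assoc, hτ2,
      mul_comm]
  have main := d1_sum_le (P := P) (b.image (cell k L)) (ξ := fun I => std (D I)) (W := std b)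
    (B := B) ?_ ?_ ?_ ?_ ?_ ?_
  · rw [hW]
    refine main.trans (ENNReal.ofReal_le_ofReal ?_)
    have e5 : 5 * (B : ℝ) = 10 * K / √v * L ^ d := by rw [hB, hτ]; ring
    rw [e5, sub_eq_add_neg]
    refine add_le_add le_rfl ?_
    -- The off-diagonal covariance is a sum over the pairs of points in different cells.
    have esum : ∑ I ∈ b.image (cell k L), covariance (std (D I)) (fun ω => std b ω - std (D I) ω) P
        = v⁻¹ * ∑ i ∈ b, ∑ j ∈ b,
          if cell k L i = cell k L j then 0 else covariance (X i) (X j) P := by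
      rw [← Finset.sum_fiberwise_of_maps_to (s := b)
        (fun i hi => Finset.mem_image_of_mem (cell k L) hi), Finset.mul_sum]
      refine Finset.sum_congr rfl fun I _ => ?_
      simp only [hstdE]
      rw [show (fun ω => std (E I) ω) = std (E I) from rfl, hcovstd,
        covariance_fun_sum_fun_sum' (fun i _ => hX2 i) fun j _ => hX2 j]
      congr 1
      refine Finset.sum_congr rfl fun i hi => ?_
      rw [hE, Finset.sum_filter, (Finset.mem_filter.1 hi).2]
      refine Finset.sum_congr rfl fun j _ => ?_
      by_cases h : cell k L j = I
      · simp [h]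
      · rw [if_pos h, if_neg (Ne.symm h)]
    have hneg : -∑ i ∈ b, ∑ j ∈ b, (if cell k L i = cell k L j then 0 else
        covariance (X i) (X j) P) ≤ κ₀ * ((n : ℝ) ^ d / L * (gammaC l d / 2)) := by
      refine le_trans ?_
        (mul_le_mul_of_nonneg_left (sum_sum_exp_off_cell_le hd hl k n hL) hκ₀.le)
      simp only [← Finset.sum_neg_distrib, Finset.mul_sum]
      refine Finset.sum_le_sum fun i _ => Finset.sum_le_sum fun j _ => ?_
      split_ifs with h
      · simp
      · rw [covariance_comm, hStat.2]
        exact hdecay _ (sub_ne_zero.2 fun hij => h (by rw [hij]))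
    rw [esum]
    calc -(10.4 * (v⁻¹ * ∑ i ∈ b, ∑ j ∈ b, (if cell k L i = cell k L j then 0 else
            covariance (X i) (X j) P)))
        = 10.4 * v⁻¹ * (-∑ i ∈ b, ∑ j ∈ b, (if cell k L i = cell k L j then 0 else
            covariance (X i) (X j) P)) := by ring
      _ ≤ 10.4 * v⁻¹ * (κ₀ * ((n : ℝ) ^ d / L * (gammaC l d / 2))) := by gcongr
      _ = _ := by rw [hv]; field_simp; ring
  · intro ω
    simp only [hstd, ← Finset.sum_mul, Finset.sum_sub_distrib]
    rw [← integral_finsetSum _ fun I _ => hSi (D I)]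
    simp only [hD]
    simp only [Finset.sum_fiberwise_of_maps_to
      (fun i hi => Finset.mem_image_of_mem (cell k L) hi)]
  · exact fun I => (((hSi (D I)).aemeasurable).sub_const _).mul_const _
  · intro I
    refine ⟨(-(K * L ^ d) - ∫ ω', ∑ j ∈ D I, X j ω' ∂P) * τ, ?_⟩
    have hall : ∀ᵐ ω ∂P, ∀ j ∈ D I, |X j ω| ≤ K :=
      (Finset.eventually_all _).2 fun j _ => hbound j
    filter_upwards [hall] with ω hω
    have hs : |∑ j ∈ D I, X j ω| ≤ K * L ^ d := by
      refine (Finset.abs_sum_le_sum_abs _ _).trans ((Finset.sum_le_card_nsmul _ _ _ hω).trans ?_)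
      rw [nsmul_eq_mul, mul_comm]
      refine mul_le_mul_of_nonneg_left ?_ hK.le
      exact_mod_cast card_filter_cell_le k n hL I
    have h := abs_le.1 hs
    have τ0 : (0 : ℝ) ≤ τ := τ.2
    simp only [hstd, hB]
    constructor
    · exact mul_le_mul_of_nonneg_right (by linarith [h.1]) τ0
    · rw [← add_mul]
      exact mul_le_mul_of_nonneg_right (by linarith [h.2]) τ0
  · intro I
    simp only [hstd]
    rw [integral_mul_const, integral_sub (hSi _) (integrable_const _)]
    simp
  · have hvar := hStat.variance_blockSum k hn
    rw [show blockSum X k n = fun ω => ∑ j ∈ b, X j ω from rfl,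
      variance_eq_integral (hSi b).aemeasurable] at hvar
    simp only [hstd, mul_pow]
    rw [integral_mul_const, pow_two (τ : ℝ), hτ2]
    have e : ∫ ω, (∑ j ∈ b, X j ω - ∫ ω', ∑ j ∈ b, X j ω' ∂P) ^ 2 ∂P = v := hvar
    rw [e, mul_inv_cancel₀ v0.ne']
  · intro I _ φ ψ M M' hφ hψ
    have h := hNA.abs_covariance_lipschitz_le hX2 (hdisj I)
      (lipschitzWith_comp_affine hφ τ (∫ ω', ∑ j ∈ D I, X j ω' ∂P))
      (lipschitzWith_comp_affine hψ τ (∫ ω', ∑ j ∈ E I, X j ω' ∂P))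
    simp only [hstdE]
    rw [show (fun ω => std (E I) ω) = std (E I) from rfl, hcovstd, ← hτ2]
    refine h.trans (le_of_eq ?_)
    push_cast
    ring

end Standardized

/-! ### Choice of the side of the cells -/

/-- The value of `a x ^ d + 2 b / x` at the minimizer `x = (b / (d a)) ^ (1 / (d + 1))` of
`a x ^ d + b / x`. -/
lemma minimizer_value {a b : ℝ} (ha : 0 < a) (hb : 0 < b) {d : ℕ} (hd : 1 ≤ d) {x : ℝ}
    (hx : 0 < x) (hxd : x ^ (d + 1) = b / (d * a)) :
    a * x ^ d + 2 * (b / x) = (a * b ^ d) ^ (1 / ((d : ℝ) + 1)) *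
      (1 / (d : ℝ) ^ ((d : ℝ) / ((d : ℝ) + 1)) + 2 * (d : ℝ) ^ (1 / ((d : ℝ) + 1))) := by
  have hd0 : (0 : ℝ) < d := by exact_mod_cast hd
  have hb' : b = d * a * x ^ (d + 1) := by rw [hxd]; field_simp
  have h1 : a * b ^ d = (a * x ^ d) ^ (d + 1) * (d : ℝ) ^ d := by rw [hb']; ring
  have hp : (1 : ℝ) / (d + 1) = ((d + 1 : ℕ) : ℝ)⁻¹ := by push_cast; rw [one_div]
  have h2 : (a * b ^ d) ^ (1 / ((d : ℝ) + 1)) = a * x ^ d * (d : ℝ) ^ ((d : ℝ) / (d + 1)) := by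
    rw [h1, Real.mul_rpow (by positivity) (by positivity)]
    congr 1
    · rw [hp, Real.pow_rpow_inv_natCast (by positivity) (by omega)]
    · rw [← Real.rpow_natCast, ← Real.rpow_mul hd0.le]; ring_nf
  have h3 : (d : ℝ) ^ ((d : ℝ) / (d + 1)) * (d : ℝ) ^ (1 / ((d : ℝ) + 1)) = d := by
    rw [← Real.rpow_add hd0, ← add_div, div_self (by positivity), Real.rpow_one]
  have h4 : b / x = d * (a * x ^ d) := by rw [hb']; field_simp; ring
  have h5 : (0 : ℝ) < (d : ℝ) ^ ((d : ℝ) / (d + 1)) := by positivity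
  rw [h2, h4, mul_add, mul_one_div, mul_div_assoc, div_self h5.ne', mul_one]
  linear_combination (-2 * (a * x ^ d)) * h3

lemma gammaC_pos {l : ℝ} (hl : 0 < l) {d : ℕ} (hd : 1 ≤ d) : 0 < gammaC l d := by
  have h1 := muC_pos hl
  have h2 := nuC_pos hl
  exact sub_pos.2 (pow_lt_pow_left₀ (by linarith) (by positivity) (by omega))

end NARandomField

theorem theorem3p1 {Ω : Type*} [MeasurableSpace Ω] (P : MeasureTheory.Measure Ω)
    [MeasureTheory.IsProbabilityMeasure P] (d : ℕ) (hd : 1 ≤ d)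
    (X : (Fin d → ℤ) → Ω → ℝ)
    (hNA : NARandomField.NegativelyAssociated P X)
    (hStat : NARandomField.SecondOrderStationary P X)
    (K : ℝ) (hK : 0 < K) (hbound : ∀ j, ∀ᵐ ω ∂P, |X j ω| ≤ K)
    (l κ₀ : ℝ) (hl : 0 < l) (hκ₀ : 0 < κ₀)
    (hdecay : ∀ k : Fin d → ℤ, k ≠ 0 →
      -NARandomField.covFun P X k ≤ κ₀ * Real.exp (-l * NARandomField.norm1 k))
    (hA : 0 < ⨅ n : ℕ+, NARandomField.avgCov P X n) :
    ∀ (k : Fin d → ℤ) (n : ℕ), 1 ≤ n →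
      max (NARandomField.threshC K l κ₀ (NARandomField.avgCov P X n) d ^ (2 / (d : ℝ)))
          (NARandomField.threshC K l κ₀ (NARandomField.avgCov P X n) d ^ (-2 / ((d : ℝ) + 2)))
        ≤ (n : ℝ) →
      NARandomField.d1 (P.map (NARandomField.stdBlockSum P X k n))
          (ProbabilityTheory.gaussianReal 0 1)
        ≤ ENNReal.ofReal (NARandomField.kappa1 K l κ₀ (NARandomField.avgCov P X n) d /
            (n : ℝ) ^ ((d : ℝ) / (2 * (d : ℝ) + 2))) := by
  intro k n hn hmax
  have hAn : 0 < NARandomField.avgCov P X n := by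
    have hbdd : BddBelow (Set.range fun n : ℕ+ => NARandomField.avgCov P X n) := by
      by_contra h
      rw [Real.iInf_of_not_bddBelow h] at hA
      exact lt_irrefl _ hA
    exact hA.trans_le (ciInf_le hbdd ⟨n, hn⟩)
  set A := NARandomField.avgCov P X n
  have hG := NARandomField.gammaC_pos hl hd
  set G : ℝ := 5.2 * κ₀ * NARandomField.gammaC l d with hGdef
  have G0 : 0 < G := by positivity
  have hd0 : (0 : ℝ) < d := by exact_mod_cast hd
  have hn0 : (0 : ℝ) < n := by exact_mod_cast hn
  have hsA : 0 < √A := Real.sqrt_pos.2 hAn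
  have hsn : 0 < √((n : ℝ) ^ d) := Real.sqrt_pos.2 (by positivity)
  have hs : √((n : ℝ) ^ d * A) = √((n : ℝ) ^ d) * √A := Real.sqrt_mul (by positivity) _
  set a : ℝ := 10 * K / √((n : ℝ) ^ d * A) with ha
  set b : ℝ := G / A with hb
  have a0 : 0 < a := by rw [ha, hs]; positivity
  have b0 : 0 < b := by positivity
  -- The minimizer of `a x ^ d + b / x` is at least one exactly when `n ≥ C ^ (2 / d)`.
  have hy1 : 1 ≤ b / (d * a) := by
    set C := NARandomField.threshC K l κ₀ A d with hC
    have hC' : C = 10 * K * d * √A / G := rfl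
    have C0 : 0 < C := by rw [hC']; positivity
    have h1 : C ^ (2 / (d : ℝ)) ≤ n := (le_max_left _ _).trans hmax
    have h2 : C ^ 2 ≤ (n : ℝ) ^ d := by
      have h := pow_le_pow_left₀ (by positivity) h1 d
      rwa [← Real.rpow_mul_natCast C0.le, div_mul_cancel₀ _ hd0.ne', Real.rpow_two] at h
    have h3 : C ≤ √((n : ℝ) ^ d) := Real.le_sqrt_of_sq_le h2
    have e : b / (d * a) = √((n : ℝ) ^ d) / C := by
      rw [ha, hb, hs, hC']
      have hAA : √A * √A = A := Real.mul_self_sqrt hAn.le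
      field_simp
      nlinarith [hAA]
    rw [e]
    exact (one_le_div C0).2 h3
  set x : ℝ := (b / (d * a)) ^ (((d + 1 : ℕ) : ℝ)⁻¹) with hx
  have hx1 : 1 ≤ x := Real.one_le_rpow hy1 (by positivity)
  have hx0 : 0 < x := by linarith
  have hxd : x ^ (d + 1) = b / (d * a) :=
    Real.rpow_inv_natCast_pow (by positivity) (by omega)
  have hL1 : 1 ≤ ⌊x⌋₊ := Nat.one_le_floor_iff _ |>.2 hx1
  have hLx : (⌊x⌋₊ : ℝ) ≤ x := Nat.floor_le hx0.le
  have hL2 : x / 2 ≤ (⌊x⌋₊ : ℝ) := by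
    have h1 := Nat.lt_floor_add_one x
    have h2 : (1 : ℝ) ≤ ⌊x⌋₊ := by exact_mod_cast hL1
    linarith
  refine (NARandomField.d1_stdBlockSum_le hd hNA hStat hK hbound hl hκ₀ hdecay k hn hAn hL1).trans
    (ENNReal.ofReal_le_ofReal ?_)
  have hbL : b / ⌊x⌋₊ ≤ 2 * (b / x) := by
    calc b / ⌊x⌋₊ ≤ b / (x / 2) := by gcongr
      _ = _ := by field_simp
  have haL : a * (⌊x⌋₊ : ℝ) ^ d ≤ a * x ^ d := by gcongr
  refine (add_le_add haL hbL).trans (le_of_eq ?_)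
  rw [NARandomField.minimizer_value a0 b0 hd hx0 hxd, NARandomField.kappa1, mul_div_right_comm]
  congr 1
  have hn2 : (n : ℝ) ^ ((d : ℝ) / (2 * (d : ℝ) + 2)) =
      √((n : ℝ) ^ d) ^ (1 / ((d : ℝ) + 1)) := by
    rw [Real.sqrt_eq_rpow, ← Real.rpow_natCast, ← Real.rpow_mul hn0.le, ← Real.rpow_mul hn0.le]
    congr 1
    field_simp
  have hA2 : A ^ ((d : ℝ) + 1 / 2) = A ^ d * √A := by
    rw [Real.rpow_add hAn, Real.rpow_natCast, Real.sqrt_eq_rpow]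
  rw [hn2, ← Real.div_rpow (by positivity) (by positivity), hA2, ha, hb, hs, div_pow]
  rw [← hGdef]
  congr 1
  field_simp
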